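/- Let $\mathcal H$ be the Hilbert space of one harmonic oscillator with Fock basis $\{|n\rangle\}_{n\in\mathbb N}$ and ladder operator $\hat a$, $\hat a|n\rangle=\sqrt n\,|n-1\rangle$. Let $\{e^{t\mathcal L}\}_{t\ge0}$ be the quantum-limited attenuator semigroup on trace-class operators, with generator $\mathcal L(\hat X)=\hat a\hat X\hat a^\dagger-\frac12\{\hat a^\dagger\hat a,\hat X\}$. For $p\ge1$ let $\|\hat X\|_p=(\mathrm{Tr}(\hat X^\dagger\hat X)^{p/2})^{1/p}$, and let $S(\hat\rho)=-\mathrm{Tr}\,\hat\rho\ln\hat\rho$ be the von Neumann entropy. For $0<a<1$ and a nonzero positive trace-class operator $\hat X$ put $$F_a(\hat X)=\left.\frac{d}{dt}\ln\left\|e^{t\mathcal L}(\hat X)\right\|_{1/a}\right|_{t=0},\qquad S_a(\hat X)=S\!\left(\frac{\hat X^{1/a}}{\mathrm{Tr}\,\hat X^{1/a}}\right),$$ where the derivative is the right derivative at $t=0$; if it does not exist as a real number, $F_a(\hat X)\in[-\infty,+\infty]$ denotes the upper right derivative ($\limsup_{t\downarrow0}$ of the difference quotients). For $0\le z<1$ let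 $\hat\omega_z=\sum_{n=0}^\infty(1-z)z^n|n\rangle\langle n|$ be the thermal Gaussian state ($\hat\omega_0=|0\rangle\langle0|$ being the vacuum). Then for every $0<a<1$ and every nonzero positive operator $\hat X$ of finite rank there is exactly one $z\in[0,1)$ with $S_a(\hat\omega_z)=S_a(\hat X)$; for this $z$ the right derivative defining $F_a(\hat\omega_z)$ exists as a real number, and $$F_a(\hat X)\le F_a(\hat\omega_z).$$ -/

import Mathlib

open Filter Topology
open scoped ENNReal

noncomputable section

namespace OneMode

section

/- `H` is the Hilbert space of one harmonic oscillator and `e` its Fock basis, `e n = |n⟩`. The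
ladder operator is the operator with `a|0⟩ = 0` and `a|n+1⟩ = √(n+1) |n⟩`, i.e. this is the
irreducible representation of the canonical commutation relation `[a, a†] = 1`. -/
variable {H : Type*} [NormedAddCommGroup H] [InnerProductSpace ℂ H] [CompleteSpace H]
  (e : HilbertBasis ℕ ℂ H)

/-- The operator `|m⟩⟨n|`. -/
def ketbra (m n : ℕ) : H →L[ℂ] H := InnerProductSpace.rankOne ℂ (e m) (e n)

/-- The projection `P_M` onto the span of `|0⟩, …, |M-1⟩`. -/
def proj (M : ℕ) : H →L[ℂ] H := ∑ n ∈ Finset.range M, ketbra e n n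

/-- The ladder operator restricted to the span of `|0⟩, …, |M-1⟩`, i.e. the bounded operator
`a P_M`, where `a|0⟩ = 0` and `a|n+1⟩ = √(n+1) |n⟩`. -/
def ladder (M : ℕ) : H →L[ℂ] H :=
  ∑ n ∈ Finset.range (M - 1), (Real.sqrt (n + 1) : ℂ) • ketbra e n (n + 1)

/-- The generator `L(X) = a X a† - ½ {a†a, X}` of the quantum-limited attenuator, written with the
restricted ladder operator. On operators `X = P_M X P_M`, it coincides with `L`, and it maps the
finite-dimensional space of these operators to itself (see `generator_ketbra`). -/
def generator (M : ℕ) : (H →L[ℂ] H) →L[ℂ] (H →L[ℂ] H) :=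
  ContinuousLinearMap.mulLeftRight ℂ (H →L[ℂ] H) (ladder e M) (star (ladder e M)) -
    (1 / 2 : ℂ) • (ContinuousLinearMap.mul ℂ (H →L[ℂ] H) (star (ladder e M) * ladder e M) +
      (ContinuousLinearMap.mul ℂ (H →L[ℂ] H)).flip (star (ladder e M) * ladder e M))

/-- The attenuator semigroup `e^{tL}`. On operators with `P_M X P_M = X` it is the exponential of
the restriction of `L` to the finite-dimensional invariant space of these operators; it is extended
to all trace-class operators by continuity (the finite-dimensional exponentials are completely
positive and trace preserving, hence trace-norm contractions, and `P_M X P_M → X` in trace norm). -/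
def attenuator (t : ℝ) (X : H →L[ℂ] H) : H →L[ℂ] H :=
  limUnder atTop fun M : ℕ =>
    NormedSpace.exp ((t : ℂ) • generator e M) (proj e M * X * proj e M)

/-- The trace, with values in `[0, ∞]`, of a positive operator. -/
def trace (A : H →L[ℂ] H) : ℝ≥0∞ := ∑' n : ℕ, ENNReal.ofReal (inner ℂ (e n) (A (e n))).re

/-- The Schatten norm `‖Y‖_p = (Tr (Y†Y)^{p/2})^{1/p}`, with values in `[0, ∞]`. -/
def schattenNorm (p : ℝ) (Y : H →L[ℂ] H) : ℝ≥0∞ :=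
  (trace e ((star Y * Y) ^ (p / 2))) ^ (1 / p)

/-- The von Neumann entropy `-Tr ρ ln ρ`, with values in `[0, ∞]`, of a quantum state `ρ`. -/
def entropy (ρ : H →L[ℂ] H) : ℝ≥0∞ := trace e (cfc Real.negMulLog ρ)

/-- `S_a(X)`, the entropy of the quantum state `X^{1/a} / Tr X^{1/a}`. -/
def entropyA (a : ℝ) (X : H →L[ℂ] H) : ℝ≥0∞ :=
  entropy e ((trace e (X ^ (1 / a))).toReal⁻¹ • X ^ (1 / a))

/-- The function `t ↦ ln ‖e^{tL}(X)‖_{1/a}`. -/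
def logNorm (a : ℝ) (X : H →L[ℂ] H) (t : ℝ) : ℝ :=
  Real.log (schattenNorm e (1 / a) (attenuator e t X)).toReal

/-- `F_a(X)`, the derivative at `t = 0` of `ln ‖e^{tL}(X)‖_{1/a}`, `t ≥ 0`, as an extended real
number. It is taken as an upper derivative, so that it makes sense also if the range of `X` is not
contained in the domain of the unbounded operator `a†a`; it is the derivative whenever the latter
exists (see `rate_eq_of_hasDerivWithinAt`). -/
def rate (a : ℝ) (X : H →L[ℂ] H) : EReal :=
  limsup (fun t : ℝ => (((logNorm e a X t - logNorm e a X 0) / t : ℝ) : EReal)) (𝓝[>] 0)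

/-- The thermal Gaussian state `ω_z = ∑ₙ (1 - z) zⁿ |n⟩⟨n|`, `0 ≤ z < 1`; here `z = 0` is the
vacuum (temperature zero). -/
def thermal (z : ℝ) : H →L[ℂ] H := ∑' n : ℕ, (((1 - z) * z ^ n : ℝ) : ℂ) • ketbra e n n

theorem ketbra_mul (k l m n : ℕ) :
    ketbra e k l * ketbra e m n = if l = m then ketbra e k n else 0 := by
  ext1 x
  simp only [ketbra, mul_apply_eq_comp, InnerProductSpace.rankOne_apply,
    inner_smul_right, orthonormal_iff_ite.1 e.orthonormal]
  split_ifs <;> simp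

theorem star_ketbra (m n : ℕ) : star (ketbra e m n) = ketbra e n m := by
  rw [ketbra, ContinuousLinearMap.star_eq_adjoint, InnerProductSpace.adjoint_rankOne]; rfl

theorem ladder_mul_ketbra (M m n : ℕ) (hm : m < M) :
    ladder e M * ketbra e m n = (Real.sqrt m : ℂ) • ketbra e (m - 1) n := by
  unfold ladder
  rw [Finset.sum_mul]
  simp only [smul_mul_assoc, ketbra_mul]
  rcases m with _ | m
  · simp
  · rw [Finset.sum_eq_single m]
    · simp
    · intro b _ hb
      simp [hb]
    · intro h
      exact absurd (Finset.mem_range.2 (by omega)) h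

theorem ketbra_mul_star_ladder (M m n : ℕ) (hn : n < M) :
    ketbra e m n * star (ladder e M) = (Real.sqrt n : ℂ) • ketbra e m (n - 1) := by
  have h := congrArg star (ladder_mul_ketbra e M n m hn)
  simpa [star_ketbra, star_smul] using h

theorem star_ladder_mul_ketbra (M m n : ℕ) (hm : m + 1 < M) :
    star (ladder e M) * ketbra e m n = (Real.sqrt (m + 1) : ℂ) • ketbra e (m + 1) n := by
  unfold ladder
  rw [star_sum, Finset.sum_mul]
  simp only [star_smul, star_ketbra, smul_mul_assoc, ketbra_mul]
  rw [Finset.sum_eq_single m]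
  · simp
  · intro b _ hb
    simp [hb]
  · intro h
    exact absurd (Finset.mem_range.2 (by omega)) h

theorem number_mul_ketbra (M m n : ℕ) (hm : m < M) :
    star (ladder e M) * ladder e M * ketbra e m n = (m : ℂ) • ketbra e m n := by
  rw [mul_assoc, ladder_mul_ketbra e M m n hm]
  rcases m with _ | m
  · simp
  · rw [mul_smul_comm, Nat.add_sub_cancel, star_ladder_mul_ketbra e M m n hm, smul_smul]
    congr 1
    push_cast
    rw [← Complex.ofReal_mul, Real.mul_self_sqrt (by positivity)]
    push_cast
    rfl

theorem ketbra_mul_number (M m n : ℕ) (hn : n < M) :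
    ketbra e m n * (star (ladder e M) * ladder e M) = (n : ℂ) • ketbra e m n := by
  have h := congrArg star (number_mul_ketbra e M n m hn)
  simpa [star_ketbra, star_smul] using h

/-- The action of the generator on the matrix units. In particular the space of the operators with
`P_M X P_M = X` is invariant, and on it `generator M'` does not depend on `M' ≥ M`. -/
theorem generator_ketbra (M m n : ℕ) (hm : m < M) (hn : n < M) :
    generator e M (ketbra e m n) =
      ((Real.sqrt m * Real.sqrt n : ℝ) : ℂ) • ketbra e (m - 1) (n - 1)
        - (((m + n : ℝ) / 2 : ℝ) : ℂ) • ketbra e m n := by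
  have h1 : ladder e M * ketbra e m n * star (ladder e M) =
      ((Real.sqrt m * Real.sqrt n : ℝ) : ℂ) • ketbra e (m - 1) (n - 1) := by
    rw [ladder_mul_ketbra e M m n hm, smul_mul_assoc, ketbra_mul_star_ladder e M _ n hn, smul_smul]
    push_cast
    rfl
  simp only [generator, sub_apply, smul_apply, add_apply,
    ContinuousLinearMap.mulLeftRight_apply,
    ContinuousLinearMap.mul_apply', ContinuousLinearMap.flip_apply, h1,
    number_mul_ketbra e M m n hm, ketbra_mul_number e M m n hn]
  congr 1
  rw [← add_smul, smul_smul]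
  congr 1
  push_cast
  ring

theorem rate_eq_of_hasDerivWithinAt {a d : ℝ} {X : H →L[ℂ] H}
    (h : HasDerivWithinAt (logNorm e a X) d (Set.Ici 0) 0) : rate e a X = (d : EReal) := by
  have h1 : Tendsto (fun t : ℝ => (logNorm e a X t - logNorm e a X 0) / t) (𝓝[>] 0) (𝓝 d) := by
    have h2 := (hasDerivWithinAt_iff_tendsto_slope' (by simp)).1 (h.mono Set.Ioi_subset_Ici_self)
    refine h2.congr fun t => ?_
    rw [slope_def_field, sub_zero]
  exact ((continuous_coe_real_ereal.tendsto d).comp h1).limsup_eq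

end

end OneMode

end

/-! The proof compares the attenuated operator with a classical process and then solves a classical
extremal problem.

Let `x 0 ≥ x 1 ≥ …` be the eigenvalues of `X`. Sums of the `k` largest eigenvalues of a positive
solution of `Y' = a Y a† - ½{a†a, Y}` grow at rate at most `k` times the next eigenvalue
(`sum_re_inner_lindblad_le`): transitions among the top `k` eigenvectors cancel, and what remains is
controlled by `[a, a†] ≤ 1`. So these sums `s_k` satisfy `s_k' ≤ k (s_{k+1} - s_k)`. The pure death
process on `ℕ` started from `x`, which is the attenuator acting on the Fock-diagonal rearrangement
of `X`, satisfies this with equality. A comparison argument (`kyFan_le_of_hasDerivAt`) therefore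
yields weak majorization at all times, and Karamata's inequality turns it into a bound on the
Schatten norms (`Diagonalises.trace_attenuator_rpow_le`). Both sides agree at `t = 0`, so the rate
of `X` is at most the derivative for the death process. With `q j = x j ^ (1/a) / Z` that derivative
is `∑ (j+1) q_{j+1}^a q_j^{1-a} - j q_j` (`Diagonalises.rate_le`).

It remains to maximise this at fixed entropy of `q` (`rate_le_geomRate`). Let `T m` be the tails of
`q` and `t m = T (m+1) / T m`. Hölder on each tail bounds the rate by the `q`-average of `geomRate a
(t m)`, while the chain rule makes the entropy of `q` exactly the `q`-average of `geomEntropy (t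
m)`. Since `geomRate a` is a concave function of `geomEntropy`, Jensen's inequality gives the value
at the geometric law with the same entropy, which is the rate of the thermal state
(`hasDerivWithinAt_logNorm_thermal`).

The analytic overhead is the unbounded ladder operator: everything is done for the truncations,
whose evolutions are shown to converge in operator norm, and the bounds pass to the limit. -/

namespace OneMode

/-! ### Ky Fan functionals. -/

section KyFan

variable {H : Type*} [NormedAddCommGroup H] [InnerProductSpace ℂ H]

/-- Rearrangement bound for a linear functional on a truncated simplex. -/
theorem sum_mul_le_sum_range {x w : ℕ → ℝ} (hx : Antitone x) (hx0 : ∀ j, 0 ≤ x j) (r k : ℕ)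
    (hw0 : ∀ j, 0 ≤ w j) (hw1 : ∀ j, w j ≤ 1) (hwk : ∑ j ∈ Finset.range r, w j ≤ k) :
    ∑ j ∈ Finset.range r, x j * w j ≤ ∑ j ∈ Finset.range k, x j := by
  rcases le_total r k with h | h
  · calc ∑ j ∈ Finset.range r, x j * w j ≤ ∑ j ∈ Finset.range r, x j :=
          Finset.sum_le_sum fun j _ => mul_le_of_le_one_right (hx0 j) (hw1 j)
      _ ≤ _ := Finset.sum_le_sum_of_subset_of_nonneg (Finset.range_mono h) fun j _ _ => hx0 j
  -- After subtracting the threshold `x k`, the coefficients are nonnegative exactly where the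
  -- weight should be full and nonpositive where it should vanish.
  · have h1 : ∑ j ∈ Finset.range r, (x j - x k) * w j ≤ ∑ j ∈ Finset.range k, (x j - x k) := by
      rw [← Finset.sum_range_add_sum_Ico _ h]
      have h2 : ∑ j ∈ Finset.Ico k r, (x j - x k) * w j ≤ 0 :=
        Finset.sum_nonpos fun j hj => mul_nonpos_of_nonpos_of_nonneg
          (sub_nonpos.2 (hx (Finset.mem_Ico.1 hj).1)) (hw0 j)
      have h3 : ∑ j ∈ Finset.range k, (x j - x k) * w j ≤ ∑ j ∈ Finset.range k, (x j - x k) :=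
        Finset.sum_le_sum fun j hj => mul_le_of_le_one_right
          (sub_nonneg.2 (hx (Finset.mem_range.1 hj).le)) (hw1 j)
      linarith
    simp only [sub_mul, Finset.sum_sub_distrib, Finset.sum_const, Finset.card_range,
      nsmul_eq_mul, ← Finset.mul_sum] at h1
    nlinarith [mul_le_mul_of_nonneg_left hwk (hx0 k)]

/-- The operator `∑_{j < r} x_j |ψ_j⟩⟨ψ_j|`. -/
noncomputable def rankOneSum (r : ℕ) (x : ℕ → ℝ) (ψ : ℕ → H) : H →L[ℂ] H :=
  ∑ j ∈ Finset.range r, (x j : ℂ) • InnerProductSpace.rankOne ℂ (ψ j) (ψ j)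

theorem rankOneSum_apply (r : ℕ) (x : ℕ → ℝ) (ψ : ℕ → H) (v : H) :
    rankOneSum r x ψ v = ∑ j ∈ Finset.range r, ((x j : ℂ) * inner ℂ (ψ j) v) • ψ j := by
  simp only [rankOneSum, sum_apply, smul_apply, InnerProductSpace.rankOne_apply, smul_smul]

theorem re_inner_rankOneSum (r : ℕ) (x : ℕ → ℝ) (ψ : ℕ → H) (v : H) :
    (inner ℂ v (rankOneSum r x ψ v)).re =
      ∑ j ∈ Finset.range r, x j * ‖(inner ℂ (ψ j) v : ℂ)‖ ^ 2 := by
  rw [rankOneSum_apply, inner_sum, Complex.re_sum]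
  refine Finset.sum_congr rfl fun j _ => ?_
  rw [inner_smul_right, mul_assoc, ← inner_conj_symm v (ψ j), Complex.mul_conj,
    Complex.normSq_eq_norm_sq, ← Complex.ofReal_mul, Complex.ofReal_re]

/-- The sum of the `k` largest eigenvalues, in variational form. -/
noncomputable def kyFan (k : ℕ) (T : H →L[ℂ] H) : ℝ :=
  sSup {s | ∃ v : Fin k → H, Orthonormal ℂ v ∧ ∑ i, (inner ℂ (v i) (T (v i))).re = s}

theorem sum_re_inner_le_norm {k : ℕ} (T : H →L[ℂ] H) {v : Fin k → H} (hv : Orthonormal ℂ v) :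
    ∑ i, (inner ℂ (v i) (T (v i))).re ≤ k * ‖T‖ := by
  calc ∑ i, (inner ℂ (v i) (T (v i))).re ≤ ∑ _i : Fin k, ‖T‖ := Finset.sum_le_sum fun i _ => by
        refine (Complex.re_le_norm _).trans ((norm_inner_le_norm _ _).trans ?_)
        have := T.le_opNorm (v i)
        simpa [hv.1 i] using this
    _ = k * ‖T‖ := by simp

theorem bddAbove_kyFan (k : ℕ) (T : H →L[ℂ] H) : BddAbove
    {s | ∃ v : Fin k → H, Orthonormal ℂ v ∧ ∑ i, (inner ℂ (v i) (T (v i))).re = s} :=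
  ⟨k * ‖T‖, by rintro _ ⟨v, hv, rfl⟩; exact sum_re_inner_le_norm T hv⟩

theorem le_kyFan {k : ℕ} (T : H →L[ℂ] H) {v : Fin k → H} (hv : Orthonormal ℂ v) :
    ∑ i, (inner ℂ (v i) (T (v i))).re ≤ kyFan k T :=
  le_csSup (bddAbove_kyFan k T) ⟨v, hv, rfl⟩

theorem kyFan_le {k : ℕ} {T : H →L[ℂ] H} {c : ℝ} (hne : ∃ v : Fin k → H, Orthonormal ℂ v)
    (h : ∀ v : Fin k → H, Orthonormal ℂ v → ∑ i, (inner ℂ (v i) (T (v i))).re ≤ c) :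
    kyFan k T ≤ c := by
  obtain ⟨v, hv⟩ := hne
  refine csSup_le ⟨_, v, hv, rfl⟩ ?_
  rintro _ ⟨v, hv, rfl⟩
  exact h v hv

/-- A Lipschitz estimate, giving continuity in time along an evolution. The existence of an
orthonormal family excludes the supremum of the empty set. -/
theorem kyFan_le_add {k : ℕ} (hne : ∃ v : Fin k → H, Orthonormal ℂ v) (T S : H →L[ℂ] H) :
    kyFan k T ≤ kyFan k S + k * ‖T - S‖ := by
  refine kyFan_le hne fun v hv => ?_
  have h1 := le_kyFan S hv
  have h2 := sum_re_inner_le_norm (T - S) hv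
  have h3 : ∑ i, (inner ℂ (v i) (T (v i))).re =
      ∑ i, (inner ℂ (v i) (S (v i))).re + ∑ i, (inner ℂ (v i) ((T - S) (v i))).re := by
    rw [← Finset.sum_add_distrib]
    refine Finset.sum_congr rfl fun i _ => ?_
    rw [← Complex.add_re, ← inner_add_right]
    simp
  linarith

theorem continuous_kyFan {k : ℕ} (hne : ∃ v : Fin k → H, Orthonormal ℂ v) :
    Continuous (kyFan k : (H →L[ℂ] H) → ℝ) := by
  refine (LipschitzWith.of_le_add_mul (k : NNReal) fun T S => ?_).continuous
  simpa [dist_eq_norm] using kyFan_le_add hne T S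

/-- Upper bound on the Ky Fan functional of `∑ x_j |φ_j⟩⟨φ_j|` for a Bessel family `φ`. -/
theorem sum_re_inner_rankOneSum_le {r k : ℕ} {x : ℕ → ℝ} {φ : ℕ → H} (hx : Antitone x)
    (hx0 : ∀ j, 0 ≤ x j) (hn : ∀ j, ‖φ j‖ ≤ 1)
    (hφ : ∀ v, ∑ j ∈ Finset.range r, ‖(inner ℂ (φ j) v : ℂ)‖ ^ 2 ≤ ‖v‖ ^ 2)
    {v : Fin k → H} (hv : Orthonormal ℂ v) :
    ∑ i, (inner ℂ (v i) (rankOneSum r x φ (v i))).re ≤ ∑ j ∈ Finset.range k, x j := by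
  simp only [re_inner_rankOneSum]
  rw [Finset.sum_comm]
  simp only [← Finset.mul_sum]
  refine sum_mul_le_sum_range hx hx0 r k (fun j => by positivity) (fun j => ?_) ?_
  · have h := hv.sum_inner_products_le (φ j) (s := Finset.univ)
    simp only [norm_inner_symm (φ j)]
    exact h.trans (pow_le_one₀ (norm_nonneg _) (hn j))
  · rw [Finset.sum_comm]
    calc _ ≤ ∑ i, ‖v i‖ ^ 2 := Finset.sum_le_sum fun i _ => hφ (v i)
      _ = k := by simp [hv.1]

theorem sum_re_inner_fin {k : ℕ} (T : H →L[ℂ] H) (v : ℕ → H) :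
    ∑ i : Fin k, (inner ℂ (v i) (T (v i))).re =
      ∑ i ∈ Finset.range k, (inner ℂ (v i) (T (v i))).re :=
  Fin.sum_univ_eq_sum_range (fun i => (inner ℂ (v i) (T (v i))).re) k

end KyFan

/-! ### Diagonalisation on a finite-dimensional subspace. -/

section Spectral

variable {H : Type*} [NormedAddCommGroup H] [InnerProductSpace ℂ H]

/-- A decreasing orthonormal diagonalisation of `T` on a subspace of dimension `n`. -/
structure Diagonalises (T : H →L[ℂ] H) (n : ℕ) (y : ℕ → ℝ) (ψ : ℕ → H) : Prop where
  antitone : Antitone y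
  nonneg : ∀ j, 0 ≤ y j
  eq_zero : ∀ j, n ≤ j → y j = 0
  orthonormal : ∀ i j, i < n → j < n → (inner ℂ (ψ i) (ψ j) : ℂ) = if i = j then 1 else 0
  vec_eq_zero : ∀ j, n ≤ j → ψ j = 0
  eq_sum : T = rankOneSum n y ψ

theorem Diagonalises.orthonormal_fin {T : H →L[ℂ] H} {n : ℕ} {y : ℕ → ℝ} {ψ : ℕ → H}
    (h : Diagonalises T n y ψ) {k : ℕ} (hk : k ≤ n) : Orthonormal ℂ fun i : Fin k => ψ i := by
  rw [orthonormal_iff_ite]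
  intro i j
  rw [h.orthonormal i j (by omega) (by omega)]
  simp [Fin.ext_iff]

theorem Diagonalises.apply_vec {T : H →L[ℂ] H} {n : ℕ} {y : ℕ → ℝ} {ψ : ℕ → H}
    (h : Diagonalises T n y ψ) (i : ℕ) : T (ψ i) = (y i : ℂ) • ψ i := by
  rcases lt_or_ge i n with hi | hi
  · rw [h.eq_sum, rankOneSum_apply, Finset.sum_eq_single i]
    · rw [h.orthonormal i i hi hi]; simp
    · intro j hj hji
      rw [h.orthonormal j i (Finset.mem_range.1 hj) hi, if_neg hji]; simp
    · intro h'; exact absurd (Finset.mem_range.2 hi) h'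
  · simp [h.vec_eq_zero i hi]

theorem Diagonalises.norm_vec_le {T : H →L[ℂ] H} {n : ℕ} {y : ℕ → ℝ} {ψ : ℕ → H}
    (h : Diagonalises T n y ψ) (i : ℕ) : ‖ψ i‖ ≤ 1 := by
  rcases lt_or_ge i n with hi | hi
  · exact ((h.orthonormal_fin le_rfl).1 ⟨i, hi⟩).le
  · simp [h.vec_eq_zero i hi]

theorem Diagonalises.bessel {T : H →L[ℂ] H} {n : ℕ} {y : ℕ → ℝ} {ψ : ℕ → H}
    (h : Diagonalises T n y ψ) (v : H) :
    ∑ j ∈ Finset.range n, ‖(inner ℂ (ψ j) v : ℂ)‖ ^ 2 ≤ ‖v‖ ^ 2 := by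
  rw [← Fin.sum_univ_eq_sum_range (fun j => ‖(inner ℂ (ψ j) v : ℂ)‖ ^ 2)]
  exact (h.orthonormal_fin le_rfl).sum_inner_products_le v (s := Finset.univ)

theorem Diagonalises.re_inner_vec {T : H →L[ℂ] H} {n : ℕ} {y : ℕ → ℝ} {ψ : ℕ → H}
    (h : Diagonalises T n y ψ) (i : ℕ) : (inner ℂ (ψ i) (T (ψ i))).re = y i := by
  rw [h.apply_vec, inner_smul_right]
  rcases lt_or_ge i n with hi | hi
  · rw [h.orthonormal i i hi hi]; simp
  · simp [h.vec_eq_zero i hi, h.eq_zero i hi]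

theorem Diagonalises.kyFan_eq {T : H →L[ℂ] H} {n : ℕ} {y : ℕ → ℝ} {ψ : ℕ → H}
    (h : Diagonalises T n y ψ) {k : ℕ} (hk : k ≤ n) :
    kyFan k T = ∑ j ∈ Finset.range k, y j := by
  refine le_antisymm (kyFan_le ⟨_, h.orthonormal_fin hk⟩ fun v hv => ?_) ?_
  · rw [h.eq_sum]
    exact sum_re_inner_rankOneSum_le h.antitone h.nonneg h.norm_vec_le h.bessel hv
  · have := le_kyFan T (h.orthonormal_fin hk)
    rw [sum_re_inner_fin] at this
    simpa only [h.re_inner_vec] using this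

/-- The spectral theorem for the restriction to `E`. The space `E` may be larger than the range:
with `E` a Fock span, Parseval's identity is available for every vector in the range of the
truncated ladder operator. -/
theorem exists_diagonalises [CompleteSpace H] {T : H →L[ℂ] H} (hT : T.IsPositive)
    (E : Submodule ℂ H)
    [FiniteDimensional ℂ E] (hE : ∀ x, T x ∈ E) :
    ∃ (y : ℕ → ℝ) (ψ : ℕ → H), Diagonalises T (Module.finrank ℂ E) y ψ ∧ (∀ j, ψ j ∈ E) ∧
      (∀ v ∈ E, ∑ j ∈ Finset.range (Module.finrank ℂ E), ‖(inner ℂ (ψ j) v : ℂ)‖ ^ 2 = ‖v‖ ^ 2) := by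
  have hsym : (T : H →ₗ[ℂ] H).IsSymmetric := hT.isSymmetric
  set S : E →ₗ[ℂ] E := (T : H →ₗ[ℂ] H).restrict (fun x _ => hE x) with hS
  have hSs : S.IsSymmetric := hsym.restrict_invariant _
  set n := Module.finrank ℂ E with hn
  set b := hSs.eigenvectorBasis hn.symm with hb
  set lam := hSs.eigenvalues hn.symm with hlam
  have hap : ∀ i, T (b i : H) = (lam i : ℂ) • (b i : H) := fun i => by
    exact congrArg (Subtype.val) (hSs.apply_eigenvectorBasis hn.symm i)
  have hpos : ∀ i, 0 ≤ lam i := fun i => by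
    have h1 := hT.re_inner_nonneg_right (b i : H)
    rw [hap, inner_smul_right] at h1
    have h2 : (inner ℂ (b i : H) (b i : H) : ℂ) = 1 := by
      rw [← Submodule.coe_inner]; simp
    rw [h2] at h1
    simpa using h1
  refine ⟨fun j => if h : j < n then lam ⟨j, h⟩ else 0, fun j => if h : j < n then (b ⟨j, h⟩ : H)
    else 0, ⟨?_, ?_, ?_, ?_, ?_, ?_⟩, ?_, ?_⟩
  · intro i j hij
    by_cases hj : j < n
    · simp only [dif_pos hj, dif_pos (hij.trans_lt hj)]
      exact hSs.eigenvalues_antitone hn.symm (by simpa using hij)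
    · simp only [dif_neg hj]
      split_ifs
      · exact hpos _
      · exact le_rfl
  · intro j; split_ifs
    · exact hpos _
    · exact le_rfl
  · intro j hj; simp [hj.not_gt]
  · intro i j hi hj
    rw [dif_pos hi, dif_pos hj, ← Submodule.coe_inner, orthonormal_iff_ite.1 b.orthonormal]
    simp
  · intro j hj; simp [hj.not_gt]
  · ext x
    rw [rankOneSum_apply]
    have h1 : T x = ∑ i, (inner ℂ (b i) (⟨T x, hE x⟩ : E)) • (b i : H) := by
      have := congrArg (Subtype.val) (b.sum_repr' (⟨T x, hE x⟩ : E))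
      simpa using this.symm
    rw [h1, ← Fin.sum_univ_eq_sum_range (fun j => ((((if h : j < n then lam ⟨j, h⟩ else 0 : ℝ)) : ℂ) *
      inner ℂ (if h : j < n then (b ⟨j, h⟩ : H) else 0) x) • (if h : j < n then (b ⟨j, h⟩ : H) else 0))]
    refine Finset.sum_congr rfl fun i _ => ?_
    simp only [Fin.is_lt, dif_pos, Fin.eta]
    congr 1
    rw [Submodule.coe_inner]
    have := hsym (b i : H) x
    simp only [ContinuousLinearMap.coe_coe, hap] at this
    rw [← this, inner_smul_left]
    simp
  · intro j; beta_reduce; split_ifs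
    · exact (b _).2
    · exact E.zero_mem
  · intro v hv
    rw [← Fin.sum_univ_eq_sum_range (fun j => ‖(inner ℂ (if h : j < n then (b ⟨j, h⟩ : H) else 0) v : ℂ)‖ ^ 2)]
    simp only [Fin.is_lt, dif_pos, Fin.eta]
    have := b.sum_sq_norm_inner_right (⟨v, hv⟩ : E)
    simpa using this

end Spectral

/-! ### Differential inequality for the sums of largest eigenvalues. -/

section Evolution

variable {H : Type*} [NormedAddCommGroup H] [InnerProductSpace ℂ H] [CompleteSpace H]

/-- Read `A i j` as the jump rate from `j` to `i`. Shift all weights by `y k`: jumps among the first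
`k` sites cancel, those to or from later sites contribute nonpositively by monotonicity, and the
shift itself costs `y k` times the net rate, at most one per site. -/
theorem sum_sub_le_of_antitone {A : ℕ → ℕ → ℝ} {y : ℕ → ℝ} {k n : ℕ} (hA : ∀ i j, 0 ≤ A i j)
    (hy : Antitone y) (hy0 : ∀ j, 0 ≤ y j) (hk : k ≤ n)
    (h : ∀ i < k, ∑ j ∈ Finset.range n, A i j - ∑ j ∈ Finset.range n, A j i ≤ 1) :
    ∑ i ∈ Finset.range k,
      (∑ j ∈ Finset.range n, y j * A i j - y i * ∑ j ∈ Finset.range n, A j i) ≤ k * y k := by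
  have h1 : ∑ i ∈ Finset.range k, ∑ j ∈ Finset.range n,
      ((y j - y k) * A i j - (y i - y k) * A j i) ≤ 0 := by
    have h2 : ∀ i ∈ Finset.range k, ∑ j ∈ Finset.range n,
        ((y j - y k) * A i j - (y i - y k) * A j i) ≤ ∑ j ∈ Finset.range k,
        ((y j - y k) * A i j - (y i - y k) * A j i) := by
      intro i hi
      rw [← Finset.sum_range_add_sum_Ico _ hk, add_le_iff_nonpos_right]
      refine Finset.sum_nonpos fun j hj => ?_
      have h3 := hy (Finset.mem_Ico.1 hj).1
      have h4 := hy (Finset.mem_range.1 hi).le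
      nlinarith [hA i j, hA j i, mul_nonneg (sub_nonneg.2 h3) (hA i j),
        mul_nonneg (sub_nonneg.2 h4) (hA j i)]
    refine (Finset.sum_le_sum h2).trans (le_of_eq ?_)
    simp only [Finset.sum_sub_distrib]
    rw [Finset.sum_comm, sub_self]
  have h5 : ∑ i ∈ Finset.range k, y k * (∑ j ∈ Finset.range n, A i j -
      ∑ j ∈ Finset.range n, A j i) ≤ ∑ i ∈ Finset.range k, y k :=
    Finset.sum_le_sum fun i hi => mul_le_of_le_one_right (hy0 k) (h i (Finset.mem_range.1 hi))
  simp only [Finset.sum_const, Finset.card_range, nsmul_eq_mul] at h5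
  rw [← sub_nonpos] at h5 ⊢
  refine le_trans (le_of_eq ?_) (add_nonpos h1 h5)
  rw [add_sub, sub_left_inj, ← Finset.sum_add_distrib]
  refine Finset.sum_congr rfl fun i _ => ?_
  simp only [Finset.sum_sub_distrib, sub_mul, Finset.mul_sum, mul_sub]
  ring

/-- The generator `X ↦ a X a† - ½ {a†a, X}` for a bounded operator `a`. -/
noncomputable def lindblad (a : H →L[ℂ] H) : (H →L[ℂ] H) →L[ℂ] (H →L[ℂ] H) :=
  ContinuousLinearMap.mulLeftRight ℂ (H →L[ℂ] H) a (star a) -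
    (1 / 2 : ℂ) • (ContinuousLinearMap.mul ℂ (H →L[ℂ] H) (star a * a) +
      (ContinuousLinearMap.mul ℂ (H →L[ℂ] H)).flip (star a * a))

theorem lindblad_apply (a X : H →L[ℂ] H) :
    lindblad a X = a * X * star a - (1 / 2 : ℂ) • (star a * a * X + X * (star a * a)) := by
  simp [lindblad]

/-- On an eigenvector the anticommutator collapses, leaving a gain term minus a loss term. -/
theorem re_inner_lindblad {a T : H →L[ℂ] H} {v : H} {c : ℝ} (hT : IsSelfAdjoint T)
    (hv : T v = (c : ℂ) • v) :
    (inner ℂ v (lindblad a T v)).re =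
      (inner ℂ (star a v) (T (star a v))).re - c * ‖a v‖ ^ 2 := by
  have h1 : (inner ℂ v ((star a) (a v)) : ℂ) = ((‖a v‖ ^ 2 : ℝ) : ℂ) := by
    rw [ContinuousLinearMap.star_eq_adjoint, ContinuousLinearMap.adjoint_inner_right,
      inner_self_eq_norm_sq_to_K]
    simp
  have h2 : (inner ℂ v (T ((star a) (a v))) : ℂ) = ((c * ‖a v‖ ^ 2 : ℝ) : ℂ) := by
    have := hT.isSymmetric v ((star a) (a v))
    simp only [ContinuousLinearMap.coe_coe] at this
    rw [← this, hv, inner_smul_left, h1]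
    simp
  have h3 : (inner ℂ v (a (T (star a v))) : ℂ) = inner ℂ (star a v) (T (star a v)) := by
    rw [ContinuousLinearMap.star_eq_adjoint, ContinuousLinearMap.adjoint_inner_left]
  rw [lindblad_apply]
  simp only [sub_apply, smul_apply, add_apply, mul_apply_eq_comp, inner_sub_right,
    inner_smul_right, inner_add_right, h3, h2, hv, map_smul, h1]
  rw [Complex.sub_re]
  congr 1
  rw [show (1 / 2 * ((c : ℂ) * ((‖a v‖ ^ 2 : ℝ) : ℂ) + ((c * ‖a v‖ ^ 2 : ℝ) : ℂ)) : ℂ) =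
    ((c * ‖a v‖ ^ 2 : ℝ) : ℂ) by push_cast; ring, Complex.ofReal_re]

/-- In the eigenbasis the generator is a jump process with rates `|⟨ψ_j, a† ψ_i⟩|²`. Total losses
are exactly `‖a ψ_i‖²` because `a` maps into `E`; for gains Bessel's inequality suffices, and
`hcomm` bounds their difference by one. -/
theorem sum_re_inner_lindblad_le {a T : H →L[ℂ] H} {E : Submodule ℂ H} {n k : ℕ} {y : ℕ → ℝ}
    {ψ : ℕ → H} (ha : ∀ v, a v ∈ E) (hcomm : ∀ v, ‖star a v‖ ^ 2 ≤ ‖a v‖ ^ 2 + ‖v‖ ^ 2)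
    (hT : IsSelfAdjoint T) (hd : Diagonalises T n y ψ)
    (hpar : ∀ v ∈ E, ∑ j ∈ Finset.range n, ‖(inner ℂ (ψ j) v : ℂ)‖ ^ 2 = ‖v‖ ^ 2) (hk : k ≤ n) :
    ∑ i ∈ Finset.range k, (inner ℂ (ψ i) (lindblad a T (ψ i))).re ≤ k * y k := by
  have hsw : ∀ i j, ‖(inner ℂ (ψ i) (star a (ψ j)) : ℂ)‖ ^ 2 = ‖(inner ℂ (ψ j) (a (ψ i)) : ℂ)‖ ^ 2 :=
    fun i j => by
      rw [ContinuousLinearMap.star_eq_adjoint, ContinuousLinearMap.adjoint_inner_right,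
        norm_inner_symm]
  have h := sum_sub_le_of_antitone (A := fun i j => ‖(inner ℂ (ψ j) (star a (ψ i)) : ℂ)‖ ^ 2)
    (fun i j => by positivity) hd.antitone hd.nonneg hk (fun i _ => by
      simp only [hsw i]
      rw [hpar _ (ha _)]
      have h1 := hd.bessel (star a (ψ i))
      have h2 := hcomm (ψ i)
      have h3 := pow_le_one₀ (n := 2) (norm_nonneg _) (hd.norm_vec_le i)
      linarith)
  refine le_trans (le_of_eq (Finset.sum_congr rfl fun i _ => ?_)) h
  rw [re_inner_lindblad hT (hd.apply_vec i)]
  simp only [hsw i]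
  rw [hpar _ (ha _)]
  conv_lhs => rw [hd.eq_sum, re_inner_rankOneSum]

/-- Along an evolution `Y' = L(Y)` of positive operators, the Ky Fan functionals are dominated by
the solution of the corresponding system of differential equations. -/
theorem kyFan_le_of_hasDerivAt {a : H →L[ℂ] H} {E : Submodule ℂ H} [FiniteDimensional ℂ E]
    (ha : ∀ v, a v ∈ E) (hcomm : ∀ v, ‖star a v‖ ^ 2 ≤ ‖a v‖ ^ 2 + ‖v‖ ^ 2)
    {Y : ℝ → H →L[ℂ] H} (hY : ∀ t, HasDerivAt Y (lindblad a (Y t)) t)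
    (hpos : ∀ t, 0 ≤ t → (Y t).IsPositive) (hE : ∀ t v, Y t v ∈ E)
    {s : ℕ → ℝ → ℝ} (hs : ∀ k t, HasDerivAt (s k) (k * (s (k + 1) t - s k t)) t)
    (hs_top : ∀ t, s (Module.finrank ℂ E) t ≤ s (Module.finrank ℂ E + 1) t)
    (h0 : ∀ k ≤ Module.finrank ℂ E, kyFan k (Y 0) ≤ s k 0) {k : ℕ}
    (hk : k ≤ Module.finrank ℂ E) {t : ℝ} (ht : 0 ≤ t) : kyFan k (Y t) ≤ s k t := by
  set n := Module.finrank ℂ E with hn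
  have hne : ∀ k ≤ n, ∃ v : Fin k → H, Orthonormal ℂ v := fun k hk => by
    obtain ⟨y, ψ, hd, -, -⟩ := exists_diagonalises (hpos 0 le_rfl) E (hE 0)
    exact ⟨_, hd.orthonormal_fin hk⟩
  have hcY : Continuous Y := continuous_iff_continuousAt.2 fun t => (hY t).continuousAt
  -- Frozen above `n`, since orthonormal families of more than `n` vectors need not exist.
  let g : ℕ → ℝ → ℝ := fun k t => if k ≤ n then kyFan k (Y t) else kyFan n (Y t)
  have hgc : ∀ k, Continuous (g k) := fun k => by
    by_cases hk : k ≤ n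
    · simp only [g, if_pos hk]
      exact (continuous_kyFan (hne k hk)).comp hcY
    · simp only [g, if_neg hk]
      exact (continuous_kyFan (hne n le_rfl)).comp hcY
  -- The bound for `k` involves level `k + 1`, so the induction runs downwards from `k = n`, where
  -- `hs_top` replaces the missing level.
  have hstep : ∀ k ≤ n, (∀ t, 0 ≤ t → g (k + 1) t ≤ s (k + 1) t ∨ k = n) →
      ∀ t, 0 ≤ t → g k t ≤ s k t := by
    intro k hk ih b hb
    have hslope : ∀ x ∈ Set.Ico 0 b, ∀ r, k * (g (k + 1) x - g k x) < r →
        ∃ᶠ z in 𝓝[>] x, slope (g k) x z < r := by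
      intro x hx r hr
      refine Eventually.frequently ?_
      -- The eigenvectors are taken at the later time `z`: they attain the supremum there and are
      -- merely admissible at `x`, so the slope of `g k` is bounded above. The price is the error
      -- `slope Y x z - lindblad a (Y z)`, which tends to zero.
      have hR : Tendsto (fun z => k * (g (k + 1) z - g k z) +
          k * ‖slope Y x z - lindblad a (Y z)‖) (𝓝[>] x)
          (𝓝 (k * (g (k + 1) x - g k x) + k * ‖lindblad a (Y x) - lindblad a (Y x)‖)) := by
        have h1 : Tendsto (slope Y x) (𝓝[>] x) (𝓝 (lindblad a (Y x))) :=
          (hasDerivAt_iff_tendsto_slope.1 (hY x)).mono_left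
            (nhdsWithin_mono _ fun z hz => ne_of_gt hz)
        have h2 : Tendsto (fun z => lindblad a (Y z)) (𝓝[>] x) (𝓝 (lindblad a (Y x))) :=
          (((lindblad a).continuous.comp hcY).tendsto x).mono_left nhdsWithin_le_nhds
        have h3 : Tendsto (fun z => (k : ℝ) * (g (k + 1) z - g k z)) (𝓝[>] x)
            (𝓝 (k * (g (k + 1) x - g k x))) :=
          ((continuous_const.mul ((hgc (k + 1)).sub (hgc k))).tendsto x).mono_left
            nhdsWithin_le_nhds
        exact h3.add ((h1.sub h2).norm.const_mul _)
      rw [sub_self, norm_zero, mul_zero, add_zero] at hR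
      filter_upwards [hR.eventually_lt_const hr, self_mem_nhdsWithin] with z hz hxz
      refine lt_of_le_of_lt ?_ hz
      have hxz' : x < z := hxz
      have hz0 : 0 ≤ z := hx.1.trans hxz'.le
      obtain ⟨y, ψ, hd, hψ, hpar⟩ := exists_diagonalises (hpos z hz0) E (hE z)
      rw [← hn] at hd hpar
      have hgk : g k z = ∑ j ∈ Finset.range k, y j := by
        simp only [g, if_pos hk, hd.kyFan_eq hk]
      have hgk1 : g (k + 1) z - g k z = y k := by
        rcases hk.lt_or_eq with h | rfl
        · rw [hgk]
          simp only [g, if_pos (Nat.succ_le_of_lt h), hd.kyFan_eq (Nat.succ_le_of_lt h),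
            Finset.sum_range_succ]
          ring
        · simp [g, hd.eq_zero]
      have hgx : ∑ i : Fin k, (inner ℂ (ψ i) (Y x (ψ i))).re ≤ g k x := by
        simp only [g, if_pos hk]
        exact le_kyFan _ (hd.orthonormal_fin hk)
      have hkey := sum_re_inner_lindblad_le ha hcomm (hpos z hz0).isSelfAdjoint hd hpar hk
      have hnorm := sum_re_inner_le_norm (slope Y x z - lindblad a (Y z)) (hd.orthonormal_fin hk)
      have hgz : g k z = ∑ i : Fin k, (inner ℂ (ψ i) (Y z (ψ i))).re := by
        rw [hgk, sum_re_inner_fin]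
        simp only [hd.re_inner_vec]
      have hsl : slope (g k) x z ≤ ∑ i : Fin k, (inner ℂ (ψ i) (slope Y x z (ψ i))).re := by
        have h4 : ∑ i : Fin k, (inner ℂ (ψ i) (slope Y x z (ψ i))).re = (z - x)⁻¹ *
            (∑ i : Fin k, (inner ℂ (ψ i) (Y z (ψ i))).re -
              ∑ i : Fin k, (inner ℂ (ψ i) (Y x (ψ i))).re) := by
          rw [← Finset.sum_sub_distrib, Finset.mul_sum]
          refine Finset.sum_congr rfl fun i _ => ?_
          rw [slope_def_module, smul_apply, sub_apply, RCLike.real_smul_eq_coe_smul (K := ℂ),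
            inner_smul_right, inner_sub_right, ← Complex.sub_re]
          exact Complex.re_ofReal_mul _ _
        rw [h4, slope_def_module, smul_eq_mul, hgz]
        exact mul_le_mul_of_nonneg_left (by linarith) (inv_nonneg.2 (sub_nonneg.2 hxz'.le))
      rw [← sum_re_inner_fin] at hkey
      have h5 : ∑ i : Fin k, (inner ℂ (ψ i) (slope Y x z (ψ i))).re =
          ∑ i : Fin k, (inner ℂ (ψ i) (lindblad a (Y z) (ψ i))).re +
          ∑ i : Fin k, (inner ℂ (ψ i) ((slope Y x z - lindblad a (Y z)) (ψ i))).re := by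
        rw [← Finset.sum_add_distrib]
        refine Finset.sum_congr rfl fun i _ => ?_
        rw [← Complex.add_re, ← inner_add_right]
        simp
      rw [hgk1]
      linarith
    -- The slack `ε * (1 + t)` makes the comparison function a strict supersolution at any point of
    -- contact; then `ε → 0`.
    have hfence : ∀ ε > 0, g k b ≤ s k b + ε * (1 + b) := by
      intro ε hε
      refine image_le_of_liminf_slope_right_lt_deriv_boundary' (a := 0) (b := b)
        (B := fun t => s k t + ε * (1 + t))
        (B' := fun t => k * (s (k + 1) t - s k t) + ε)
        (hgc k).continuousOn hslope ?_ ?_ ?_ ?_ ⟨hb, le_rfl⟩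
      · have := h0 k hk
        simp only [g, if_pos hk]
        linarith
      · exact Continuous.continuousOn (by
          have : Continuous (s k) := continuous_iff_continuousAt.2 fun t => (hs k t).continuousAt
          fun_prop)
      · intro x _
        have h6 : HasDerivAt (fun t : ℝ => ε * (1 + t)) ε x := by
          simpa using ((hasDerivAt_id x).const_add 1).const_mul ε
        exact ((hs k x).add h6).hasDerivWithinAt
      · intro x hx hxe
        have h7 : g (k + 1) x - g k x ≤ s (k + 1) x - s k x := by
          rcases ih x hx.1 with h | h
          · have : 0 ≤ ε * (1 + x) := mul_nonneg hε.le (by linarith [hx.1])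
            linarith
          · have h8 : g (k + 1) x = g k x := by simp [g, h]
            have h9 := hs_top x
            rw [← h] at h9
            linarith
        have := mul_le_mul_of_nonneg_left h7 (Nat.cast_nonneg (α := ℝ) k)
        linarith
    have h10 : Tendsto (fun ε : ℝ => s k b + ε * (1 + b)) (𝓝[>] 0) (𝓝 (s k b + 0 * (1 + b))) :=
      ((continuous_const.add (continuous_id.mul continuous_const)).tendsto 0).mono_left
        nhdsWithin_le_nhds
    rw [zero_mul, add_zero] at h10
    exact ge_of_tendsto h10 (by filter_upwards [self_mem_nhdsWithin] with ε hε using hfence ε hε)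
  have hall : ∀ m ≤ n, ∀ t, 0 ≤ t → g (n - m) t ≤ s (n - m) t := by
    intro m
    induction m with
    | zero => exact fun _ => hstep n le_rfl fun t _ => Or.inr rfl
    | succ m ih =>
      intro hm
      refine hstep _ (Nat.sub_le _ _) fun t ht => Or.inl ?_
      have := ih (by omega) t ht
      rwa [show n - (m + 1) + 1 = n - m by omega]
  have := hall (n - k) (Nat.sub_le _ _) t ht
  rw [Nat.sub_sub_self hk] at this
  simpa only [g, if_pos hk] using this

end Evolution

/-! ### Exponentials and uniqueness for linear differential equations. -/

section ExpLemmas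

variable {F : Type*} [NormedAddCommGroup F] [NormedSpace ℂ F]

theorem HasDerivAt.clm_apply_real {c : ℝ → F →L[ℂ] F} {c' : F →L[ℂ] F} {u : ℝ → F} {u' : F} {t : ℝ}
    (hc : HasDerivAt c c' t) (hu : HasDerivAt u u' t) :
    HasDerivAt (fun t => c t (u t)) (c' (u t) + c t u') t := by
  have h := ((isBoundedBilinearMap_apply (𝕜 := ℂ) (E := F) (F := F)).hasFDerivAt
    (c t, u t)).restrictScalars ℝ |>.comp_hasDerivAt t (hc.prodMk hu)
  convert! h using 1
  simp [add_comm]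

variable [CompleteSpace F]

theorem hasDerivAt_exp_real_smul (A : F →L[ℂ] F) (t : ℝ) :
    HasDerivAt (fun t : ℝ => NormedSpace.exp ((t : ℂ) • A)) (A * NormedSpace.exp ((t : ℂ) • A)) t := by
  have h := (hasDerivAt_exp_smul_const' A (t : ℂ)).scomp t Complex.ofRealCLM.hasDerivAt
  convert! h using 1
  simp

theorem hasDerivAt_exp_real_smul' (A : F →L[ℂ] F) (t : ℝ) :
    HasDerivAt (fun t : ℝ => NormedSpace.exp ((t : ℂ) • A)) (NormedSpace.exp ((t : ℂ) • A) * A) t := by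
  have h := (hasDerivAt_exp_smul_const A (t : ℂ)).scomp t Complex.ofRealCLM.hasDerivAt
  convert! h using 1
  simp

theorem hasDerivAt_exp_smul_apply (A : F →L[ℂ] F) (x : F) (t : ℝ) :
    HasDerivAt (fun t : ℝ => NormedSpace.exp ((t : ℂ) • A) x)
      (A (NormedSpace.exp ((t : ℂ) • A) x)) t := by
  simpa using HasDerivAt.clm_apply_real (hasDerivAt_exp_real_smul A t) (hasDerivAt_const t x)

theorem exp_smul_mul_exp_neg_smul (A : F →L[ℂ] F) (t : ℝ) :
    NormedSpace.exp ((t : ℂ) • A) * NormedSpace.exp ((t : ℂ) • (-A)) = 1 := by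
  let _ : NormedAlgebra ℚ (F →L[ℂ] F) := .restrictScalars ℚ ℂ _
  rw [smul_neg, ← NormedSpace.exp_add_of_commute (Commute.neg_right rfl)]
  simp

/-- Uniqueness of the solution of `v' = A v`. -/
theorem eq_exp_smul_apply {A : F →L[ℂ] F} {v : ℝ → F} (hv : ∀ t, HasDerivAt v (A (v t)) t)
    (t : ℝ) : v t = NormedSpace.exp ((t : ℂ) • A) (v 0) := by
  have h1 : ∀ t : ℝ, HasDerivAt (fun t : ℝ => NormedSpace.exp ((t : ℂ) • (-A)) (v t)) 0 t := by
    intro t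
    simpa using HasDerivAt.clm_apply_real (hasDerivAt_exp_real_smul' (-A) t) (hv t)
  have h4 : NormedSpace.exp ((t : ℂ) • (-A)) (v t) = v 0 := by
    have := is_const_of_deriv_eq_zero (fun t => (h1 t).differentiableAt) (fun t => (h1 t).deriv) t 0
    simpa using this
  rw [← h4, ← mul_apply_eq_comp, exp_smul_mul_exp_neg_smul]
  rfl

end ExpLemmas

/-! ### Positivity of the semigroup. -/

section Positivity

variable {H : Type*} [NormedAddCommGroup H] [InnerProductSpace ℂ H] [CompleteSpace H]

/-- `e^{-t n / 2}` with `n = a†a`. -/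
noncomputable def damping (a : H →L[ℂ] H) (t : ℝ) : H →L[ℂ] H :=
  NormedSpace.exp ((t : ℂ) • (-(1 / 2 : ℂ) • (star a * a)))

theorem isSelfAdjoint_damping (a : H →L[ℂ] H) (t : ℝ) : IsSelfAdjoint (damping a t) := by
  rw [damping, IsSelfAdjoint, NormedSpace.star_exp]
  simp [star_smul]

theorem damping_zero (a : H →L[ℂ] H) : damping a 0 = 1 := by simp [damping]

/-- Since `a` lowers `a†a` by one, commuting it past `e^{-t a†a/2}` costs a scalar factor. Only `[a,
a†a] = a` is used, which survives truncation, unlike the canonical commutation relation. -/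
theorem mul_damping {a : H →L[ℂ] H} (hc : a * (star a * a) = star a * a * a + a) (t : ℝ) :
    a * damping a t = (Real.exp (-t / 2) : ℂ) • (damping a t * a) := by
  set g := -(1 / 2 : ℂ) • (star a * a) with hg
  have hag : a * g = g * a - (1 / 2 : ℂ) • a := by
    rw [hg, mul_smul_comm, hc, smul_mul_assoc, smul_add, neg_smul (1 / 2 : ℂ) a, sub_eq_add_neg]
  have h1 : ∀ t : ℝ, HasDerivAt (fun t : ℝ => (Real.exp (-t / 2) : ℂ) • (damping a t * a *
      NormedSpace.exp ((t : ℂ) • (-g)))) 0 t := by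
    intro t
    have h2 := ((hasDerivAt_exp_real_smul' g t).mul_const a).mul (hasDerivAt_exp_real_smul (-g) t)
    have h3 : HasDerivAt (fun t : ℝ => (Real.exp (-t / 2) : ℂ)) ((-1 / 2 : ℂ) * Real.exp (-t / 2)) t := by
      have : HasDerivAt (fun t : ℝ => Real.exp (-t / 2)) (Real.exp (-t / 2) * (-1 / 2)) t :=
        (((hasDerivAt_id t).neg).div_const 2).exp
      convert! this.ofReal_comp using 1
      push_cast; ring
    convert! h3.smul h2 using 1
    rw [neg_mul, mul_neg, ← sub_eq_add_neg, mul_assoc _ a (g * _), ← mul_assoc a g, hag]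
    have h6 : ∀ P E : H →L[ℂ] H, P * g * a * E - P * ((g * a - (1 / 2 : ℂ) • a) * E) =
        (1 / 2 : ℂ) • (P * a * E) := fun P E => by
      simp only [sub_mul, mul_sub, smul_mul_assoc, mul_smul_comm, mul_assoc, sub_sub_cancel]
    rw [h6, smul_smul, Pi.mul_apply, ← add_smul]
    rw [show (Real.exp (-t / 2) : ℂ) * (1 / 2) + -1 / 2 * (Real.exp (-t / 2) : ℂ) = 0 by ring, zero_smul]
  have h4 := is_const_of_deriv_eq_zero (fun t => (h1 t).differentiableAt) (fun t => (h1 t).deriv) t 0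
  simp only [damping_zero, Complex.ofReal_zero, zero_smul, NormedSpace.exp_zero, one_mul, mul_one,
    neg_zero, zero_div, Real.exp_zero, Complex.ofReal_one, one_smul] at h4
  have h5 : NormedSpace.exp ((t : ℂ) • (-g)) * damping a t = 1 := by
    simpa [damping, hg] using exp_smul_mul_exp_neg_smul (-g) t
  calc a * damping a t = ((Real.exp (-t / 2) : ℂ) • (damping a t * a *
        NormedSpace.exp ((t : ℂ) • (-g)))) * damping a t := by rw [h4]
    _ = _ := by rw [smul_mul_assoc, mul_assoc, h5, mul_one]

/-- Every term of the exponential series is positive; keep the zeroth. -/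
theorem sub_nonneg_exp_conj {a X : H →L[ℂ] H} (hX : 0 ≤ X) {c : ℝ} (hc : 0 ≤ c) :
    X ≤ NormedSpace.exp ((c : ℂ) • ContinuousLinearMap.mulLeftRight ℂ (H →L[ℂ] H) a (star a)) X := by
  set J := ContinuousLinearMap.mulLeftRight ℂ (H →L[ℂ] H) a (star a) with hJ
  have hJp : ∀ n : ℕ, 0 ≤ (J ^ n) X := by
    intro n
    induction n with
    | zero => simpa using hX
    | succ n ih =>
      rw [pow_succ', mul_apply_eq_comp, hJ, ContinuousLinearMap.mulLeftRight_apply]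
      exact star_right_conjugate_nonneg ih a
  have h1 : HasSum (fun n : ℕ => ((n.factorial : ℂ)⁻¹ • ((c : ℂ) • J) ^ n) X)
      (NormedSpace.exp ((c : ℂ) • J) X) :=
    (NormedSpace.exp_series_hasSum_exp' (𝕂 := ℂ) ((c : ℂ) • J)).mapL (ContinuousLinearMap.apply ℂ _ X)
  have h2 := le_hasSum h1 0 fun n _ => by
    rw [smul_apply, smul_pow, smul_apply, smul_smul]
    have : ((n.factorial : ℂ)⁻¹ * (c : ℂ) ^ n) = ((((n.factorial : ℝ)⁻¹ * c ^ n : ℝ)) : ℂ) := by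
      push_cast; rfl
    rw [this, Complex.coe_smul]
    exact smul_nonneg (by positivity) (hJp n)
  simpa using h2

/-- Interaction picture: once the damping is factored out, the jump map acts with strength `e^{-t}`,
whose integral is the effective time `1 - e^{-t}`. Both sides solve the same linear equation. -/
theorem exp_lindblad_apply {a : H →L[ℂ] H} (hc : a * (star a * a) = star a * a * a + a)
    (X : H →L[ℂ] H) (t : ℝ) :
    NormedSpace.exp ((t : ℂ) • lindblad a) X = damping a t *
      NormedSpace.exp (((1 - Real.exp (-t) : ℝ) : ℂ) •
        ContinuousLinearMap.mulLeftRight ℂ (H →L[ℂ] H) a (star a)) X * damping a t := by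
  set J := ContinuousLinearMap.mulLeftRight ℂ (H →L[ℂ] H) a (star a) with hJ
  set g := -(1 / 2 : ℂ) • (star a * a) with hg
  have h1 : ∀ t, HasDerivAt (fun t => damping a t *
      NormedSpace.exp (((1 - Real.exp (-t) : ℝ) : ℂ) • J) X * damping a t)
      (lindblad a (damping a t *
      NormedSpace.exp (((1 - Real.exp (-t) : ℝ) : ℂ) • J) X * damping a t)) t := by
    intro t
    have h2 : HasDerivAt (fun t : ℝ => 1 - Real.exp (-t)) (Real.exp (-t)) t := by
      simpa using ((hasDerivAt_neg t).exp).const_sub 1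
    have h3 := (hasDerivAt_exp_smul_apply J X (1 - Real.exp (-t))).scomp t h2
    have h4 := ((hasDerivAt_exp_real_smul g t).mul h3).mul (hasDerivAt_exp_real_smul' g t)
    convert! h4 using 1
    simp only [Function.comp_apply]
    set W := NormedSpace.exp (((1 - Real.exp (-t) : ℝ) : ℂ) • J) X
    change _ = (g * damping a t * W + damping a t * (Real.exp (-t)) • J W) * damping a t +
      damping a t * W * (damping a t * g)
    have h5 : a * (damping a t * W * damping a t) * star a =
        (Real.exp (-t) : ℝ) • (damping a t * J W * damping a t) := by
      have h6 := mul_damping hc t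
      have h7 := congrArg star h6
      rw [star_mul, star_smul, star_mul, (isSelfAdjoint_damping a t).star_eq] at h7
      have h8 : a * (damping a t * W * damping a t) * star a =
        (a * damping a t) * W * (damping a t * star a) := by simp only [mul_assoc]
      rw [h8, h6, h7, hJ, ContinuousLinearMap.mulLeftRight_apply]
      simp only [smul_mul_assoc, mul_smul_comm, smul_smul, mul_assoc]
      rw [← Complex.coe_smul]
      congr 1
      simp only [Complex.star_def, Complex.conj_ofReal]
      rw [← Complex.ofReal_mul, ← Real.exp_add]
      ring_nf
    rw [lindblad_apply, h5, hg]
    simp only [add_mul, mul_assoc, smul_mul_assoc, mul_smul_comm, smul_add, neg_smul,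
      neg_mul, mul_neg]
    abel
  rw [eq_exp_smul_apply h1 t]
  congr 1
  simp [damping_zero]

/-- The no-jump contribution is a lower bound. It gives positivity of the evolution and, later, that
the evolved operator is nonzero. -/
theorem damping_mul_self_le_exp_lindblad {a X : H →L[ℂ] H}
    (hc : a * (star a * a) = star a * a * a + a) (hX : 0 ≤ X) {t : ℝ} (ht : 0 ≤ t) :
    damping a t * X * damping a t ≤ NormedSpace.exp ((t : ℂ) • lindblad a) X := by
  rw [exp_lindblad_apply hc, ← sub_nonneg, ← sub_mul, ← mul_sub]
  exact (isSelfAdjoint_damping a t).conjugate_nonneg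
    (sub_nonneg.2 (sub_nonneg_exp_conj hX (by simpa using ht)))

theorem exp_lindblad_nonneg {a X : H →L[ℂ] H}
    (hc : a * (star a * a) = star a * a * a + a) (hX : 0 ≤ X) {t : ℝ} (ht : 0 ≤ t) :
    0 ≤ NormedSpace.exp ((t : ℂ) • lindblad a) X :=
  ((isSelfAdjoint_damping a t).conjugate_nonneg hX).trans (damping_mul_self_le_exp_lindblad hc hX ht)

theorem damping_apply {a : H →L[ℂ] H} {v : H} {m : ℝ} (hv : (star a * a) v = (m : ℂ) • v) (t : ℝ) :
    damping a t v = (Real.exp (-t * m / 2) : ℂ) • v := by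
  have h1 : ∀ t : ℝ, HasDerivAt (fun t : ℝ => (Real.exp (-t * m / 2) : ℂ) • v)
      ((-(1 / 2 : ℂ) • (star a * a)) ((Real.exp (-t * m / 2) : ℂ) • v)) t := by
    intro t
    have h2 : HasDerivAt (fun t : ℝ => Real.exp (-t * m / 2)) (Real.exp (-t * m / 2) * (-1 * m / 2)) t :=
      ((((hasDerivAt_id t).neg).mul_const m).div_const 2).exp
    convert! h2.ofReal_comp.smul_const v using 1
    rw [map_smul, smul_apply, hv, smul_smul, smul_smul]
    congr 1
    push_cast; ring
  have h2 := eq_exp_smul_apply h1 t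
  simpa [damping] using h2.symm

end Positivity

/-! ### The truncated ladder operators. -/

section Ladder

variable {H : Type*} [NormedAddCommGroup H] [InnerProductSpace ℂ H] [CompleteSpace H]
  (e : HilbertBasis ℕ ℂ H)

theorem exp_ofReal_zero_smul_apply {F : Type*} [NormedAddCommGroup F] [NormedSpace ℂ F]
    (A : F →L[ℂ] F) (x : F) : NormedSpace.exp (((0 : ℝ) : ℂ) • A) x = x := by
  rw [Complex.ofReal_zero, zero_smul, NormedSpace.exp_zero]
  rfl

theorem generator_eq_lindblad (M : ℕ) : generator e M = lindblad (ladder e M) := rfl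

theorem proj_apply (M : ℕ) (v : H) :
    proj e M v = ∑ n ∈ Finset.range M, (inner ℂ (e n) v : ℂ) • e n := by
  simp [proj, sum_apply, ketbra]

theorem isSelfAdjoint_proj (M : ℕ) : IsSelfAdjoint (proj e M) := by
  rw [IsSelfAdjoint, proj, star_sum]
  simp [star_ketbra]

theorem proj_mul_ketbra {M m : ℕ} (hm : m < M) (n : ℕ) :
    proj e M * ketbra e m n = ketbra e m n := by
  simp [proj, Finset.sum_mul, ketbra_mul, hm]

theorem proj_mul_proj {m M : ℕ} (hm : m ≤ M) : proj e M * proj e m = proj e m := by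
  conv_lhs => rw [proj.eq_1 e m]
  rw [Finset.mul_sum, proj]
  exact Finset.sum_congr rfl fun n hn =>
    proj_mul_ketbra e ((Finset.mem_range.1 hn).trans_le hm) n

theorem proj_mul_ladder (M : ℕ) : proj e M * ladder e M = ladder e M := by
  rw [ladder, Finset.mul_sum]
  refine Finset.sum_congr rfl fun n hn => ?_
  rw [mul_smul_comm, proj_mul_ketbra]
  have := Finset.mem_range.1 hn
  omega

theorem ladder_mul_proj (M : ℕ) : ladder e M * proj e M = ladder e M := by
  rw [ladder, Finset.sum_mul]
  refine Finset.sum_congr rfl fun n hn => ?_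
  have := Finset.mem_range.1 hn
  have h : n + 1 < M := by omega
  rw [smul_mul_assoc, proj, Finset.mul_sum]
  simp [ketbra_mul, h]

theorem star_ladder_mul_proj (M : ℕ) : star (ladder e M) * proj e M = star (ladder e M) := by
  have := congrArg star (proj_mul_ladder e M)
  simpa [(isSelfAdjoint_proj e _).star_eq] using this

theorem proj_mul_star_ladder (M : ℕ) : proj e M * star (ladder e M) = star (ladder e M) := by
  have := congrArg star (ladder_mul_proj e M)
  simpa [(isSelfAdjoint_proj e _).star_eq] using this

theorem ladder_mul_number (M : ℕ) :
    ladder e M * (star (ladder e M) * ladder e M) =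
      star (ladder e M) * ladder e M * ladder e M + ladder e M := by
  have h : ∀ m ∈ Finset.range M, ladder e M * (star (ladder e M) * ladder e M) * ketbra e m m =
      (star (ladder e M) * ladder e M * ladder e M + ladder e M) * ketbra e m m := by
    intro m hm
    have hm := Finset.mem_range.1 hm
    rw [mul_assoc, number_mul_ketbra e M m m hm, mul_smul_comm, ladder_mul_ketbra e M m m hm,
      add_mul, mul_assoc, ladder_mul_ketbra e M m m hm, mul_smul_comm,
      number_mul_ketbra e M _ m (by omega), smul_smul, smul_smul, ← add_smul]
    rcases m with _ | m
    · simp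
    · congr 1
      push_cast
      ring
  have h2 := Finset.sum_congr rfl h
  rw [← Finset.mul_sum, ← Finset.mul_sum, ← proj, add_mul, mul_assoc, mul_assoc,
    ladder_mul_proj, mul_assoc, ladder_mul_proj] at h2
  exact h2

theorem ladder_mul_proj_of_le {m M : ℕ} (hm : m ≤ M) :
    ladder e M * proj e m = ladder e m * proj e m := by
  simp only [proj, Finset.mul_sum]
  refine Finset.sum_congr rfl fun n hn => ?_
  have hn := Finset.mem_range.1 hn
  rw [ladder_mul_ketbra e M n n (hn.trans_le hm), ladder_mul_ketbra e m n n hn]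

theorem number_mul_proj_of_le {m M : ℕ} (hm : m ≤ M) :
    star (ladder e M) * ladder e M * proj e m = star (ladder e m) * ladder e m * proj e m := by
  simp only [proj, Finset.mul_sum]
  refine Finset.sum_congr rfl fun n hn => ?_
  have hn := Finset.mem_range.1 hn
  rw [number_mul_ketbra e M n n (hn.trans_le hm), number_mul_ketbra e m n n hn]

theorem norm_sum_smul_sq (s : Finset ℕ) (c : ℕ → ℂ) :
    ‖∑ n ∈ s, c n • e n‖ ^ 2 = ∑ n ∈ s, ‖c n‖ ^ 2 := by
  have h := e.orthonormal.inner_sum c c s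
  rw [inner_self_eq_norm_sq_to_K] at h
  have h2 : ∀ n, (starRingEnd ℂ) (c n) * c n = ((‖c n‖ ^ 2 : ℝ) : ℂ) := fun n => by
    rw [mul_comm, Complex.mul_conj, Complex.normSq_eq_norm_sq]
  simp only [h2] at h
  apply Complex.ofReal_injective
  refine Eq.trans ?_ (h.trans ?_) <;> simp

theorem ladder_apply (M : ℕ) (v : H) : ladder e M v =
    ∑ n ∈ Finset.range (M - 1), ((Real.sqrt (n + 1) : ℂ) * inner ℂ (e (n + 1)) v) • e n := by
  simp only [ladder, sum_apply, smul_apply, ketbra, InnerProductSpace.rankOne_apply, smul_smul]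

theorem star_ladder_apply (M : ℕ) (v : H) : star (ladder e M) v =
    ∑ n ∈ Finset.range (M - 1), ((Real.sqrt (n + 1) : ℂ) * inner ℂ (e n) v) • e (n + 1) := by
  simp only [ladder, star_sum, star_smul, star_ketbra, sum_apply, smul_apply, Complex.star_def,
    Complex.conj_ofReal]
  simp only [ketbra, InnerProductSpace.rankOne_apply, smul_smul]

/-- This is `[a, a†] ≤ 1`: truncation alters the commutator only by a negative term at the top
level. -/
theorem norm_star_ladder_sq_le (M : ℕ) (v : H) :
    ‖star (ladder e M) v‖ ^ 2 ≤ ‖ladder e M v‖ ^ 2 + ‖v‖ ^ 2 := by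
  set c : ℕ → ℝ := fun n => ‖(inner ℂ (e n) v : ℂ)‖ ^ 2 with hc
  have hs : ∀ n : ℕ, ∀ z : ℂ, ‖(Real.sqrt (n + 1) : ℂ) * z‖ ^ 2 = (n + 1 : ℝ) * ‖z‖ ^ 2 := by
    intro n z
    rw [norm_mul, mul_pow, Complex.norm_real, Real.norm_eq_abs, sq_abs, Real.sq_sqrt (by positivity)]
  have h1 : ‖ladder e M v‖ ^ 2 = ∑ n ∈ Finset.range (M - 1), (n + 1 : ℝ) * c (n + 1) := by
    rw [ladder_apply, norm_sum_smul_sq]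
    exact Finset.sum_congr rfl fun n _ => hs n _
  have h2 : ‖star (ladder e M) v‖ ^ 2 = ∑ n ∈ Finset.range (M - 1), (n + 1 : ℝ) * c n := by
    rw [star_ladder_apply]
    have := norm_sum_smul_sq e ((Finset.range (M - 1)).map ⟨(· + 1), add_left_injective 1⟩)
      (fun n => (Real.sqrt ((n - 1 : ℕ) + 1) : ℂ) * inner ℂ (e (n - 1)) v)
    simp only [Finset.sum_map, Function.Embedding.coeFn_mk, Nat.add_sub_cancel] at this
    rw [this]
    exact Finset.sum_congr rfl fun n _ => hs n _
  have h3 : ∑ n ∈ Finset.range (M - 1 + 1), c n ≤ ‖v‖ ^ 2 :=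
    e.orthonormal.sum_inner_products_le v
  have h4 : ∑ n ∈ Finset.range (M - 1 + 1), (n : ℝ) * c n =
      ∑ n ∈ Finset.range (M - 1), (n + 1 : ℝ) * c (n + 1) := by
    rw [Finset.sum_range_succ']
    simp
  have h5 : ∑ n ∈ Finset.range (M - 1), (n + 1 : ℝ) * c n ≤
      ∑ n ∈ Finset.range (M - 1 + 1), (n + 1 : ℝ) * c n := by
    rw [Finset.sum_range_succ]
    have : 0 ≤ ((M - 1 : ℕ) + 1 : ℝ) * c (M - 1) := by positivity
    linarith
  have h6 : ∑ n ∈ Finset.range (M - 1 + 1), (n + 1 : ℝ) * c n =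
      ∑ n ∈ Finset.range (M - 1 + 1), (n : ℝ) * c n + ∑ n ∈ Finset.range (M - 1 + 1), c n := by
    rw [← Finset.sum_add_distrib]
    exact Finset.sum_congr rfl fun n _ => by ring
  rw [h1, h2]
  linarith

/-- The span of the first `M` Fock states. -/
noncomputable def fockSpan (M : ℕ) : Submodule ℂ H := Submodule.span ℂ (Set.range fun i : Fin M => e i)

instance (M : ℕ) : FiniteDimensional ℂ (fockSpan e M) :=
  FiniteDimensional.span_of_finite ℂ (Set.finite_range _)

theorem finrank_fockSpan (M : ℕ) : Module.finrank ℂ (fockSpan e M) = M := by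
  have h : LinearIndependent ℂ fun i : Fin M => e i :=
    e.orthonormal.linearIndependent.comp (fun i : Fin M => (i : ℕ)) Fin.val_injective
  exact (finrank_span_eq_card h).trans (Fintype.card_fin M)

theorem proj_mem_fockSpan (M : ℕ) (v : H) : proj e M v ∈ fockSpan e M := by
  rw [proj_apply]
  exact Submodule.sum_mem _ fun n hn => Submodule.smul_mem _ _
    (Submodule.subset_span ⟨⟨n, Finset.mem_range.1 hn⟩, rfl⟩)

theorem norm_proj_apply_le (M : ℕ) (v : H) : ‖proj e M v‖ ≤ ‖v‖ := by
  rw [← sq_le_sq₀ (norm_nonneg _) (norm_nonneg _), proj_apply, norm_sum_smul_sq]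
  exact e.orthonormal.sum_inner_products_le v

theorem tendsto_proj_apply (v : H) : Tendsto (fun M => proj e M v) atTop (𝓝 v) := by
  simp only [proj_apply]
  simpa [HilbertBasis.repr_apply_apply] using (e.hasSum_repr v).tendsto_sum_nat

/-- On operators supported on `P` the generator sees only `a P` and `a†a P`; this makes different
truncations consistent. -/
theorem lindblad_eq_of_mul_proj {a b P Z : H →L[ℂ] H} (hP : IsSelfAdjoint P) (hab : a * P = b * P)
    (hn : star a * a * P = star b * b * P) (hZ : P * Z * P = Z) (hPP : P * P = P) :
    lindblad a Z = lindblad b Z := by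
  have hPZ : P * Z = Z := by rw [← hZ, ← mul_assoc, ← mul_assoc, hPP]
  have hZP : Z * P = Z := by rw [← hZ, mul_assoc, hPP]
  have hab' : P * star a = P * star b := by
    have := congrArg star hab
    simpa [hP.star_eq] using this
  have hn' : P * (star a * a) = P * (star b * b) := by
    have := congrArg star hn
    simpa [hP.star_eq] using this
  have h1 : a * Z * star a = b * Z * star b := by
    rw [← hZ]
    calc a * (P * Z * P) * star a = (a * P) * Z * (P * star a) := by simp only [mul_assoc]
      _ = (b * P) * Z * (P * star b) := by rw [hab, hab']
      _ = _ := by simp only [mul_assoc]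
  have h2 : star a * a * Z = star b * b * Z := by
    rw [← hPZ, ← mul_assoc, hn, mul_assoc]
  have h3 : Z * (star a * a) = Z * (star b * b) := by
    rw [← hZP, mul_assoc, hn', mul_assoc]
  rw [lindblad_apply, lindblad_apply, h1, h2, h3]

theorem proj_conj_exp_generator {M : ℕ} {X : H →L[ℂ] H} (hX : proj e M * X * proj e M = X) (t : ℝ) :
    proj e M * NormedSpace.exp ((t : ℂ) • generator e M) X * proj e M =
      NormedSpace.exp ((t : ℂ) • generator e M) X := by
  have h1 : ∀ t : ℝ, HasDerivAt (fun t : ℝ => proj e M *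
      NormedSpace.exp ((t : ℂ) • generator e M) X * proj e M)
      (generator e M (proj e M * NormedSpace.exp ((t : ℂ) • generator e M) X * proj e M)) t := by
    intro t
    have h2 := ((hasDerivAt_exp_smul_apply (generator e M) X t).const_mul (proj e M)).mul_const
      (proj e M)
    convert! h2 using 1
    set W := NormedSpace.exp ((t : ℂ) • generator e M) X
    set a := ladder e M with ha
    set P := proj e M
    have e1 : a * P = a := ladder_mul_proj e M
    have e2 : P * a = a := proj_mul_ladder e M
    have e3 : star a * P = star a := star_ladder_mul_proj e M
    have e4 : P * star a = star a := proj_mul_star_ladder e M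
    have e1' : ∀ Z, a * (P * Z) = a * Z := fun Z => by rw [← mul_assoc, e1]
    have e2' : ∀ Z, P * (a * Z) = a * Z := fun Z => by rw [← mul_assoc, e2]
    have e3' : ∀ Z, star a * (P * Z) = star a * Z := fun Z => by rw [← mul_assoc, e3]
    have e4' : ∀ Z, P * (star a * Z) = star a * Z := fun Z => by rw [← mul_assoc, e4]
    rw [generator_eq_lindblad, lindblad_apply, lindblad_apply, ← ha]
    simp only [mul_sub, sub_mul, mul_add, add_mul, mul_smul_comm, smul_mul_assoc, mul_assoc,
      e1, e3, e4, e1', e2', e4']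
  rw [eq_exp_smul_apply h1 t, exp_ofReal_zero_smul_apply, hX]

theorem exp_generator_eq_of_le {m M : ℕ} (hm : m ≤ M) {X : H →L[ℂ] H}
    (hX : proj e m * X * proj e m = X) (t : ℝ) :
    NormedSpace.exp ((t : ℂ) • generator e M) X = NormedSpace.exp ((t : ℂ) • generator e m) X := by
  have h1 : ∀ t : ℝ, HasDerivAt (fun t : ℝ => NormedSpace.exp ((t : ℂ) • generator e m) X)
      (generator e M (NormedSpace.exp ((t : ℂ) • generator e m) X)) t := by
    intro t
    have h2 := hasDerivAt_exp_smul_apply (generator e m) X t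
    rwa [generator_eq_lindblad e M, lindblad_eq_of_mul_proj (isSelfAdjoint_proj e m)
      (ladder_mul_proj_of_le e hm) (number_mul_proj_of_le e hm) (proj_conj_exp_generator e hX t)
      (proj_mul_proj e le_rfl)]
  rw [eq_exp_smul_apply h1 t, exp_ofReal_zero_smul_apply]

/-- Domination of the Ky Fan functionals for the truncated attenuator. -/
theorem kyFan_exp_generator_le {M : ℕ} {X : H →L[ℂ] H} (hX : 0 ≤ X)
    (hXM : proj e M * X * proj e M = X)
    {s : ℕ → ℝ → ℝ} (hs : ∀ k t, HasDerivAt (s k) (k * (s (k + 1) t - s k t)) t)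
    (hs_top : ∀ t, s M t ≤ s (M + 1) t) (h0 : ∀ k ≤ M, kyFan k X ≤ s k 0) {k : ℕ}
    (hk : k ≤ M) {t : ℝ} (ht : 0 ≤ t) :
    kyFan k (NormedSpace.exp ((t : ℂ) • generator e M) X) ≤ s k t := by
  refine kyFan_le_of_hasDerivAt (a := ladder e M) (E := fockSpan e M)
    (Y := fun t : ℝ => NormedSpace.exp ((t : ℂ) • generator e M) X) (fun v => ?_)
    (norm_star_ladder_sq_le e M) (fun t => hasDerivAt_exp_smul_apply (generator e M) X t)
    (fun t ht => ?_) (fun t v => ?_) hs ?_ ?_ ?_ ht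
  · rw [← proj_mul_ladder]
    exact proj_mem_fockSpan e M _
  · rw [← ContinuousLinearMap.nonneg_iff_isPositive]
    exact exp_lindblad_nonneg (ladder_mul_number e M) hX ht
  · rw [← proj_conj_exp_generator e hXM t, mul_assoc]
    exact proj_mem_fockSpan e M _
  · rwa [finrank_fockSpan]
  · rw [finrank_fockSpan]
    simpa only [exp_ofReal_zero_smul_apply] using h0
  · rwa [finrank_fockSpan]

end Ladder

/-! ### Convergence of the truncated evolutions. -/

section Existence

variable {H : Type*} [NormedAddCommGroup H] [InnerProductSpace ℂ H] [CompleteSpace H]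
  (e : HilbertBasis ℕ ℂ H)

theorem norm_le_of_kyFan_one_le {T : H →L[ℂ] H} (hT : 0 ≤ T) {c : ℝ} (hc : 0 ≤ c)
    (h : kyFan 1 T ≤ c) : ‖T‖ ≤ c := by
  rw [CStarAlgebra.norm_le_iff_le_algebraMap T hc hT, ContinuousLinearMap.le_def]
  refine ⟨?_, fun v => ?_⟩
  · exact (((IsSelfAdjoint.algebraMap _ (IsSelfAdjoint.all c))).sub
      (IsSelfAdjoint.of_nonneg hT)).isSymmetric
  · have h1 : ContinuousLinearMap.reApplyInnerSelf T v ≤ c * ‖v‖ ^ 2 := by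
      by_cases hv : v = 0
      · simp [hv, ContinuousLinearMap.reApplyInnerSelf]
      have hn : ‖v‖ ≠ 0 := norm_ne_zero_iff.2 hv
      have ho : Orthonormal ℂ fun _ : Fin 1 => ((‖v‖⁻¹ : ℝ) : ℂ) • v := by
        refine ⟨fun _ => ?_, fun i j hij => absurd (Subsingleton.elim i j) hij⟩
        rw [norm_smul, Complex.norm_real, Real.norm_of_nonneg (by positivity), inv_mul_cancel₀ hn]
      have h2 := (le_kyFan T ho).trans h
      simp only [Finset.univ_unique, Finset.sum_const, Finset.card_singleton, one_smul, map_smul,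
        inner_smul_left, inner_smul_right, Complex.conj_ofReal, Complex.re_ofReal_mul] at h2
      rw [ContinuousLinearMap.reApplyInnerSelf, ← inner_conj_symm, RCLike.conj_re]
      change (inner ℂ v (T v)).re ≤ _
      calc (inner ℂ v (T v)).re = (‖v‖⁻¹ * (‖v‖⁻¹ * (inner ℂ v (T v)).re)) * ‖v‖ ^ 2 := by
            field_simp
        _ ≤ _ := mul_le_mul_of_nonneg_right h2 (by positivity)
    have h3 : ContinuousLinearMap.reApplyInnerSelf (algebraMap ℝ (H →L[ℂ] H) c - T) v =
        c * ‖v‖ ^ 2 - ContinuousLinearMap.reApplyInnerSelf T v := by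
      simp only [ContinuousLinearMap.reApplyInnerSelf, sub_apply, inner_sub_left, map_sub]
      congr 1
      rw [Algebra.algebraMap_eq_smul_one, smul_apply, RCLike.real_smul_eq_coe_smul (K := ℂ),
        inner_smul_left]
      simp
      norm_cast
      exact Or.inl rfl
    exact h3 ▸ sub_nonneg.2 h1

theorem exists_orthonormal (e : HilbertBasis ℕ ℂ H) (k : ℕ) : ∃ v : Fin k → H, Orthonormal ℂ v :=
  ⟨fun i => e i, e.orthonormal.comp (fun i : Fin k => (i : ℕ)) Fin.val_injective⟩

theorem rankOne_self_nonneg (u : H) : 0 ≤ InnerProductSpace.rankOne ℂ u u := by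
  rw [ContinuousLinearMap.nonneg_iff_isPositive]
  exact InnerProductSpace.isPositive_rankOne_self u

theorem kyFan_rankOne_le (e : HilbertBasis ℕ ℂ H) (k : ℕ) (u : H) :
    kyFan k (InnerProductSpace.rankOne ℂ u u : H →L[ℂ] H) ≤ ‖u‖ ^ 2 := by
  refine kyFan_le (exists_orthonormal e k) fun v hv => ?_
  refine le_trans (le_of_eq (Finset.sum_congr rfl fun i _ => ?_))
    (hv.sum_inner_products_le u (s := Finset.univ))
  rw [InnerProductSpace.rankOne_apply, inner_smul_right, ← inner_conj_symm u (v i),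
    mul_comm, Complex.mul_conj, Complex.normSq_eq_norm_sq, Complex.ofReal_re]

theorem mul_rankOne_mul (A : H →L[ℂ] H) (u v : H) : A * InnerProductSpace.rankOne ℂ u v * star A =
    InnerProductSpace.rankOne ℂ (A u) (A v) := by
  ext x
  simp [mul_apply_eq_comp, ContinuousLinearMap.star_eq_adjoint,
    ContinuousLinearMap.adjoint_inner_right]

theorem proj_rankOne {M : ℕ} {u : H} (hu : proj e M u = u) :
    proj e M * InnerProductSpace.rankOne ℂ u u * proj e M = InnerProductSpace.rankOne ℂ u u := by
  have := mul_rankOne_mul (proj e M) u u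
  rwa [(isSelfAdjoint_proj e M).star_eq, hu] at this

/-- The constant `‖u‖ ^ 2` solves the comparison system for all `k` at once, and for positive
operators the first Ky Fan functional controls the norm. -/
theorem norm_exp_generator_rankOne_le {M : ℕ} {u : H} (hu : proj e M u = u) {t : ℝ} (ht : 0 ≤ t) :
    ‖NormedSpace.exp ((t : ℂ) • generator e M) (InnerProductSpace.rankOne ℂ u u)‖ ≤ ‖u‖ ^ 2 := by
  rcases Nat.eq_zero_or_pos M with rfl | hM
  · have : u = 0 := by rw [← hu]; simp [proj]
    simp [this]
  refine norm_le_of_kyFan_one_le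
    (exp_lindblad_nonneg (ladder_mul_number e M) (rankOne_self_nonneg u) ht) (by positivity) ?_
  exact kyFan_exp_generator_le e (rankOne_self_nonneg u) (proj_rankOne e hu)
    (s := fun _ _ => ‖u‖ ^ 2) (fun k t => by simpa using hasDerivAt_const t (‖u‖ ^ 2))
    (fun _ => le_rfl) (fun k _ => kyFan_rankOne_le e k u) hM ht

/-- Polarisation writes the difference as a quarter of `|p⟩⟨p| - |q⟩⟨q|`. Rescaling `u - w` by
`δ^{-1/2}` and `u + w` by `δ^{1/2}` balances the two, so `‖p‖²` and `‖q‖²` are of order `δ`; the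
bound for positive rank-one operators applies to each. -/
theorem norm_exp_generator_rankOne_sub_le {M : ℕ} {u w : H} (hu : proj e M u = u)
    (hw : proj e M w = w) {t : ℝ} (ht : 0 ≤ t) {δ : ℝ} (hδ : 0 < δ) (hd : ‖u - w‖ ≤ δ)
    (hs : ‖u + w‖ ≤ 2) :
    ‖NormedSpace.exp ((t : ℂ) • generator e M)
      (InnerProductSpace.rankOne ℂ u u - InnerProductSpace.rankOne ℂ w w)‖ ≤ 3 * δ := by
  set c : ℝ := (Real.sqrt δ)⁻¹ with hc
  have hsq : Real.sqrt δ ≠ 0 := (Real.sqrt_pos.2 hδ).ne'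
  set p : H := (c : ℂ) • (u - w) + ((Real.sqrt δ : ℝ) : ℂ) • (u + w) with hp
  set q : H := (c : ℂ) • (u - w) - ((Real.sqrt δ : ℝ) : ℂ) • (u + w) with hq
  have hcc : (c : ℂ) * ((Real.sqrt δ : ℝ) : ℂ) = 1 := by
    rw [← Complex.ofReal_mul, hc, inv_mul_cancel₀ hsq, Complex.ofReal_one]
  have h1 : InnerProductSpace.rankOne ℂ u u - InnerProductSpace.rankOne ℂ w w =
      (1 / 4 : ℂ) • (InnerProductSpace.rankOne ℂ p p - InnerProductSpace.rankOne ℂ q q) := by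
    ext x
    simp only [hp, hq, sub_apply, smul_apply, InnerProductSpace.rankOne_apply, inner_add_left,
      inner_sub_left, inner_smul_left, Complex.conj_ofReal]
    match_scalars
    · linear_combination (-(inner ℂ u x : ℂ)) * hcc
    · linear_combination (inner ℂ w x : ℂ) * hcc
  have hpp : proj e M p = p := by simp only [hp, map_add, map_smul, map_sub, hu, hw]
  have hqq : proj e M q = q := by simp only [hq, map_add, map_smul, map_sub, hu, hw]
  have hpar : ‖p‖ ^ 2 + ‖q‖ ^ 2 ≤ 10 * δ := by
    have h2 := parallelogram_law_with_norm ℂ ((c : ℂ) • (u - w)) (((Real.sqrt δ : ℝ) : ℂ) • (u + w))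
    rw [norm_smul, norm_smul, Complex.norm_real, Complex.norm_real,
      Real.norm_of_nonneg (by positivity), Real.norm_of_nonneg (by positivity)] at h2
    have h3 : c * ‖u - w‖ * (c * ‖u - w‖) ≤ δ := by
      have h4 : c * ‖u - w‖ ≤ Real.sqrt δ := by
        rw [hc, inv_mul_le_iff₀ (Real.sqrt_pos.2 hδ), Real.mul_self_sqrt hδ.le]
        exact hd
      calc _ ≤ Real.sqrt δ * Real.sqrt δ := mul_self_le_mul_self (by positivity) h4
        _ = δ := Real.mul_self_sqrt hδ.le
    have h5 : Real.sqrt δ * ‖u + w‖ * (Real.sqrt δ * ‖u + w‖) ≤ 4 * δ := by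
      have h6 : Real.sqrt δ * ‖u + w‖ * (Real.sqrt δ * ‖u + w‖) = δ * (‖u + w‖ * ‖u + w‖) := by
        rw [mul_mul_mul_comm, Real.mul_self_sqrt hδ.le]
      rw [h6]
      nlinarith [mul_self_le_mul_self (norm_nonneg _) hs]
    rw [← hp, ← hq] at h2
    nlinarith
  have h7 := norm_exp_generator_rankOne_le e hpp ht
  have h8 := norm_exp_generator_rankOne_le e hqq ht
  rw [h1, map_smul, map_sub, norm_smul]
  have h9 := norm_sub_le (NormedSpace.exp ((t : ℂ) • generator e M) (InnerProductSpace.rankOne ℂ p p))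
    (NormedSpace.exp ((t : ℂ) • generator e M) (InnerProductSpace.rankOne ℂ q q))
  have h10 : ‖(1 / 4 : ℂ)‖ = 1 / 4 := by norm_num
  rw [h10]
  linarith

theorem exists_tendsto_exp_generator_rankOne {u : H} (hu : ‖u‖ ≤ 1) {t : ℝ} (ht : 0 ≤ t) :
    ∃ Y : H →L[ℂ] H, Tendsto (fun M => NormedSpace.exp ((t : ℂ) • generator e M)
      (proj e M * InnerProductSpace.rankOne ℂ u u * proj e M)) atTop (𝓝 Y) := by
  refine cauchySeq_tendsto_of_complete (Metric.cauchySeq_iff'.2 fun ε hε => ?_)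
  have h1 := (tendsto_proj_apply e u).cauchySeq
  obtain ⟨N, hN⟩ := Metric.cauchySeq_iff'.1 h1 (ε / 4) (by positivity)
  refine ⟨N, fun M hM => ?_⟩
  have h2 : ∀ M, proj e M * InnerProductSpace.rankOne ℂ u u * proj e M =
      InnerProductSpace.rankOne ℂ (proj e M u) (proj e M u) := fun M => by
    simpa [(isSelfAdjoint_proj e M).star_eq] using mul_rankOne_mul (proj e M) u u
  have h3 : ∀ {m M}, m ≤ M → proj e M (proj e m u) = proj e m u := fun {m M} h => by
    rw [← mul_apply_eq_comp, proj_mul_proj e h]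
  have h4 := norm_proj_apply_le e M u
  have h5 := norm_proj_apply_le e N u
  rw [dist_eq_norm, h2, h2, ← exp_generator_eq_of_le e hM (proj_rankOne e (h3 le_rfl)), ← map_sub]
  refine (norm_exp_generator_rankOne_sub_le e (h3 le_rfl) (h3 hM) ht (by positivity)
    (dist_eq_norm (proj e M u) _ ▸ (hN M hM).le) ((norm_add_le _ _).trans (by linarith))).trans_lt ?_
  linarith

theorem exists_tendsto_exp_generator (r : ℕ) (x : ℕ → ℝ) {ψ : ℕ → H} (hψ : ∀ j, ‖ψ j‖ ≤ 1)
    {t : ℝ} (ht : 0 ≤ t) : Tendsto (fun M => NormedSpace.exp ((t : ℂ) • generator e M)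
      (proj e M * rankOneSum r x ψ * proj e M)) atTop (𝓝 (attenuator e t (rankOneSum r x ψ))) := by
  choose Y hY using fun j => exists_tendsto_exp_generator_rankOne e (hψ j) ht
  have h : Tendsto (fun M => NormedSpace.exp ((t : ℂ) • generator e M)
      (proj e M * rankOneSum r x ψ * proj e M)) atTop
      (𝓝 (∑ j ∈ Finset.range r, (x j : ℂ) • Y j)) := by
    simp only [rankOneSum, Finset.mul_sum, Finset.sum_mul, map_sum, mul_smul_comm, smul_mul_assoc,
      map_smul]
    exact tendsto_finsetSum _ fun j _ => (hY j).const_smul _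
  have h2 : attenuator e t (rankOneSum r x ψ) = _ := h.limUnder_eq
  rwa [h2]

theorem mul_rankOneSum_mul (A : H →L[ℂ] H) (r : ℕ) (x : ℕ → ℝ) (ψ : ℕ → H) :
    A * rankOneSum r x ψ * star A = rankOneSum r x fun j => A (ψ j) := by
  simp only [rankOneSum, Finset.mul_sum, Finset.sum_mul, mul_smul_comm, smul_mul_assoc,
    mul_rankOne_mul]

theorem rankOneSum_nonneg (r : ℕ) {x : ℕ → ℝ} (hx : ∀ j, 0 ≤ x j) (ψ : ℕ → H) :
    0 ≤ rankOneSum r x ψ := by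
  refine Finset.sum_nonneg fun j _ => ?_
  rw [Complex.coe_smul]
  exact smul_nonneg (hx j) (rankOne_self_nonneg _)

/-- Domination of the Ky Fan functionals for the truncations of a finite rank operator. -/
theorem Diagonalises.kyFan_exp_generator_le {X : H →L[ℂ] H} {r : ℕ} {x : ℕ → ℝ} {ψ : ℕ → H}
    (hX : Diagonalises X r x ψ) {M : ℕ} {s : ℕ → ℝ → ℝ}
    (hs : ∀ k t, HasDerivAt (s k) (k * (s (k + 1) t - s k t)) t)
    (hs_top : ∀ t, s M t ≤ s (M + 1) t) (h0 : ∀ k, s k 0 = ∑ j ∈ Finset.range k, x j) {k : ℕ}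
    (hk : k ≤ M) {t : ℝ} (ht : 0 ≤ t) :
    kyFan k (NormedSpace.exp ((t : ℂ) • generator e M) (proj e M * X * proj e M)) ≤ s k t := by
  have h1 : proj e M * X * proj e M = rankOneSum r x fun j => proj e M (ψ j) := by
    rw [← mul_rankOneSum_mul, (isSelfAdjoint_proj e M).star_eq, hX.eq_sum]
  refine OneMode.kyFan_exp_generator_le e ?_ ?_ hs hs_top (fun k _ => ?_) hk ht
  · rw [h1]
    exact rankOneSum_nonneg r hX.nonneg _
  · have := proj_mul_proj e (le_refl M)
    rw [mul_assoc, mul_assoc, this, ← mul_assoc, ← mul_assoc, this]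
  · rw [h1, h0]
    -- Projected eigenvectors are no longer orthonormal but still form a Bessel family, which is all
    -- that is needed.
    refine kyFan_le (exists_orthonormal e k) fun v hv => sum_re_inner_rankOneSum_le hX.antitone
      hX.nonneg (fun j => (norm_proj_apply_le e M _).trans (hX.norm_vec_le j)) (fun v => ?_) hv
    refine le_trans (le_of_eq (Finset.sum_congr rfl fun j _ => ?_))
      ((hX.bessel (proj e M v)).trans
        (pow_le_pow_left₀ (norm_nonneg _) (norm_proj_apply_le e M v) 2))
    rw [← (isSelfAdjoint_proj e M).star_eq, ContinuousLinearMap.star_eq_adjoint,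
      ContinuousLinearMap.adjoint_inner_left, ← ContinuousLinearMap.star_eq_adjoint,
      (isSelfAdjoint_proj e M).star_eq]

end Existence

/-! ### Functional calculus, traces and Karamata's inequality. -/

section Calculus

variable {H : Type*} [NormedAddCommGroup H] [InnerProductSpace ℂ H] [CompleteSpace H]

theorem aeval_apply_eigenvector {T : H →L[ℂ] H} {v : H} {c : ℝ} (hv : T v = (c : ℂ) • v)
    (p : Polynomial ℝ) : (Polynomial.aeval T p) v = ((p.eval c : ℝ) : ℂ) • v := by
  have hpow : ∀ n : ℕ, (T ^ n) v = ((c ^ n : ℝ) : ℂ) • v := by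
    intro n
    induction n with
    | zero => simp
    | succ n ih =>
      rw [pow_succ, mul_apply_eq_comp, hv, map_smul, ih, smul_smul]
      congr 1
      push_cast
      ring
  induction p using Polynomial.induction_on' with
  | add p q hp hq => rw [map_add, add_apply, hp, hq, Polynomial.eval_add, Complex.ofReal_add, add_smul]
  | monomial n b =>
    rw [Polynomial.aeval_monomial, Polynomial.eval_monomial, mul_apply_eq_comp, hpow,
      Algebra.algebraMap_eq_smul_one, smul_apply, RCLike.real_smul_eq_coe_smul (K := ℂ),
      one_apply_eq_self, smul_smul, Complex.ofReal_mul]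
    rfl

/-- The continuous functional calculus acts on eigenvectors by evaluation at the eigenvalue. -/
theorem cfc_apply_eigenvector {T : H →L[ℂ] H} (hT : IsSelfAdjoint T) {v : H} {c : ℝ}
    (hv : T v = (c : ℂ) • v) {f : ℝ → ℝ} (hf : Continuous f) :
    cfc f T v = (f c : ℂ) • v := by
  -- The interval contains the spectrum and also `c`, which need not be in the spectrum because `v`
  -- may be zero. Weierstrass approximation on it reduces the claim to polynomials.
  set R := max (‖T‖ * ‖(1 : H →L[ℂ] H)‖) |c| with hR
  have hc : c ∈ Set.Icc (-R) R := abs_le.1 (le_max_right _ _)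
  have hs : ∀ x ∈ spectrum ℝ T, x ∈ Set.Icc (-R) R := fun x hx =>
    abs_le.1 ((spectrum.norm_le_norm_mul_of_mem hx).trans (le_max_left _ _))
  have key : ∀ ε > 0, ‖cfc f T v - (f c : ℂ) • v‖ ≤ ε * (2 * ‖v‖) := by
    intro ε hε
    obtain ⟨p, hp⟩ := exists_polynomial_near_of_continuousOn (-R) R f hf.continuousOn ε hε
    have h1 : ‖cfc f T - Polynomial.aeval T p‖ ≤ ε := by
      rw [← cfc_polynomial p T hT, ← cfc_sub f p.eval T hf.continuousOn p.continuous.continuousOn]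
      refine norm_cfc_le hε.le fun x hx => ?_
      rw [← norm_neg, neg_sub]
      exact (hp x (hs x hx)).le
    have h2 : cfc f T v - (f c : ℂ) • v = (cfc f T - Polynomial.aeval T p) v +
        ((p.eval c - f c : ℝ) : ℂ) • v := by
      rw [sub_apply, aeval_apply_eigenvector hv, Complex.ofReal_sub, sub_smul]
      abel
    rw [h2]
    refine (norm_add_le _ _).trans ?_
    have h3 := (cfc f T - Polynomial.aeval T p).le_of_opNorm_le h1 v
    have h4 : ‖((p.eval c - f c : ℝ) : ℂ) • v‖ ≤ ε * ‖v‖ := by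
      rw [norm_smul, Complex.norm_real]
      exact mul_le_mul_of_nonneg_right (hp c hc).le (norm_nonneg _)
    linarith
  rw [← sub_eq_zero, ← norm_le_zero_iff]
  have h5 : Tendsto (fun ε : ℝ => ε * (2 * ‖v‖)) (𝓝[>] 0) (𝓝 (0 * (2 * ‖v‖))) :=
    ((continuous_id.mul continuous_const).tendsto 0).mono_left nhdsWithin_le_nhds
  rw [zero_mul] at h5
  exact ge_of_tendsto h5 (by filter_upwards [self_mem_nhdsWithin] with ε hε using key ε hε)

theorem rpow_apply_eigenvector {T : H →L[ℂ] H} (hT : 0 ≤ T) {v : H} {c : ℝ}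
    (hv : T v = (c : ℂ) • v) {p : ℝ} (hp : 0 ≤ p) : (T ^ p) v = ((c ^ p : ℝ) : ℂ) • v := by
  rw [CFC.rpow_eq_cfc_real hT]
  exact cfc_apply_eigenvector (IsSelfAdjoint.of_nonneg hT) hv (Real.continuous_rpow_const hp)

theorem Diagonalises.nonneg_op {T : H →L[ℂ] H} {n : ℕ} {y : ℕ → ℝ} {ψ : ℕ → H}
    (h : Diagonalises T n y ψ) : 0 ≤ T := by
  rw [h.eq_sum]
  exact rankOneSum_nonneg n h.nonneg ψ

theorem Diagonalises.cfc_eq {T : H →L[ℂ] H} {n : ℕ} {y : ℕ → ℝ} {ψ : ℕ → H}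
    (h : Diagonalises T n y ψ) {f : ℝ → ℝ} (hf : Continuous f) (hf0 : f 0 = 0) :
    cfc f T = rankOneSum n (fun j => f (y j)) ψ := by
  have hsa := IsSelfAdjoint.of_nonneg h.nonneg_op
  ext x
  set x' := ∑ j ∈ Finset.range n, (inner ℂ (ψ j) x : ℂ) • ψ j with hx'
  have h1 : T (x - x') = ((0 : ℝ) : ℂ) • (x - x') := by
    rw [Complex.ofReal_zero, zero_smul, map_sub, sub_eq_zero, hx', map_sum]
    conv_lhs => rw [h.eq_sum, rankOneSum_apply]
    refine Finset.sum_congr rfl fun j _ => ?_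
    rw [map_smul, h.apply_vec, smul_smul, mul_comm]
  have h2 : cfc f T (x - x') = 0 := by
    rw [cfc_apply_eigenvector hsa h1 hf, hf0]
    simp
  rw [rankOneSum_apply, ← sub_add_cancel x x', map_add, h2, zero_add, sub_add_cancel, hx', map_sum]
  refine Finset.sum_congr rfl fun j _ => ?_
  rw [map_smul, cfc_apply_eigenvector hsa (h.apply_vec j) hf, smul_smul, mul_comm]

theorem Diagonalises.rpow_eq {T : H →L[ℂ] H} {n : ℕ} {y : ℕ → ℝ} {ψ : ℕ → H}
    (h : Diagonalises T n y ψ) {p : ℝ} (hp : 0 < p) :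
    T ^ p = rankOneSum n (fun j => y j ^ p) ψ := by
  rw [CFC.rpow_eq_cfc_real h.nonneg_op]
  exact h.cfc_eq (Real.continuous_rpow_const hp.le) (Real.zero_rpow hp.ne')

theorem rpow_star_mul_self {Y : H →L[ℂ] H} (hY : 0 ≤ Y) {p : ℝ} (hp : 0 < p) :
    (star Y * Y) ^ (p / 2) = Y ^ p := by
  rw [(IsSelfAdjoint.of_nonneg hY).star_eq, ← pow_two, ← CFC.rpow_natCast Y 2 hY,
    CFC.rpow_rpow_of_exponent_nonneg Y _ _ (by norm_num) (by positivity) hY]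
  congr 1
  push_cast
  ring

theorem spectrum_nnreal_subset_Icc {T : H →L[ℂ] H} {R : ℝ} (hR : ‖T‖ ≤ R) :
    spectrum NNReal T ⊆ Set.Icc 0 (R * ‖(1 : H →L[ℂ] H)‖).toNNReal := by
  intro x hx
  refine ⟨zero_le, ?_⟩
  rw [Real.le_toNNReal_iff_coe_le (by have := (norm_nonneg T).trans hR; positivity)]
  have h1 : (x : ℝ) ∈ spectrum ℝ T := by
    have := (spectrum.algebraMap_mem_iff ℝ (R := NNReal) (a := T) (r := x)).2 hx
    simpa using this
  have h2 := spectrum.norm_le_norm_mul_of_mem h1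
  exact ((Real.le_norm_self _).trans h2).trans (mul_le_mul_of_nonneg_right hR (norm_nonneg _))

theorem tendsto_rpow {Y : ℕ → H →L[ℂ] H} {Y₀ : H →L[ℂ] H} (hY : Tendsto Y atTop (𝓝 Y₀))
    (hpos : ∀ M, 0 ≤ Y M) {p : ℝ} (hp : 0 ≤ p) :
    Tendsto (fun M => Y M ^ p) atTop (𝓝 (Y₀ ^ p)) := by
  have h1 : ∀ᶠ M in atTop, ‖Y M‖ ≤ ‖Y₀‖ + 1 :=
    (hY.norm.eventually_lt_const (lt_add_one _)).mono fun _ h => h.le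
  refine Filter.Tendsto.cfc_nnreal (s := Set.Icc 0 ((‖Y₀‖ + 1) * ‖(1 : H →L[ℂ] H)‖).toNNReal)
    isCompact_Icc _ hY ?_ (Eventually.of_forall hpos) ?_ ?_ ?_
  · exact h1.mono fun M h => spectrum_nnreal_subset_Icc h
  · exact spectrum_nnreal_subset_Icc (lt_add_one _).le
  · exact ge_of_tendsto' hY hpos
  · exact (NNReal.continuous_rpow_const hp).continuousOn

variable (e : HilbertBasis ℕ ℂ H)

theorem hasSum_re_inner_rankOneSum (n : ℕ) (z : ℕ → ℝ) {ψ : ℕ → H}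
    (hψ : ∀ j < n, ‖ψ j‖ = 1) :
    HasSum (fun i => (inner ℂ (e i) (rankOneSum n z ψ (e i))).re) (∑ j ∈ Finset.range n, z j) := by
  simp only [re_inner_rankOneSum]
  refine hasSum_sum fun j hj => ?_
  have h1 := Complex.hasSum_re (e.hasSum_inner_mul_inner (ψ j) (ψ j))
  rw [inner_self_eq_norm_sq_to_K, hψ j (Finset.mem_range.1 hj)] at h1
  have h2 := h1.mul_left (z j)
  have h3 : ∀ i, (inner ℂ (ψ j) (e i) * inner ℂ (e i) (ψ j) : ℂ).re =
      ‖(inner ℂ (ψ j) (e i) : ℂ)‖ ^ 2 := fun i => by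
    rw [← inner_conj_symm (e i) (ψ j), Complex.mul_conj, Complex.normSq_eq_norm_sq,
      Complex.ofReal_re]
  simpa only [h3, map_one, one_pow, Complex.one_re, mul_one] using h2

theorem trace_rankOneSum (n : ℕ) {z : ℕ → ℝ} (hz : ∀ j, 0 ≤ z j) {ψ : ℕ → H}
    (hψ : ∀ j < n, ‖ψ j‖ = 1) :
    trace e (rankOneSum n z ψ) = ENNReal.ofReal (∑ j ∈ Finset.range n, z j) := by
  have h := hasSum_re_inner_rankOneSum e n z hψ
  rw [trace, ← h.tsum_eq, ENNReal.ofReal_tsum_of_nonneg (fun i => ?_) h.summable]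
  rw [re_inner_rankOneSum]
  exact Finset.sum_nonneg fun j _ => mul_nonneg (hz j) (by positivity)

theorem Diagonalises.norm_vec {T : H →L[ℂ] H} {n : ℕ} {y : ℕ → ℝ} {ψ : ℕ → H}
    (h : Diagonalises T n y ψ) : ∀ j < n, ‖ψ j‖ = 1 :=
  fun j hj => (h.orthonormal_fin le_rfl).1 ⟨j, hj⟩

theorem Diagonalises.trace_rpow {T : H →L[ℂ] H} {n : ℕ} {y : ℕ → ℝ} {ψ : ℕ → H}
    (h : Diagonalises T n y ψ) {p : ℝ} (hp : 0 < p) :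
    trace e (T ^ p) = ENNReal.ofReal (∑ j ∈ Finset.range n, y j ^ p) := by
  rw [h.rpow_eq hp, trace_rankOneSum e n (fun j => Real.rpow_nonneg (h.nonneg j) p) h.norm_vec]

theorem schattenNorm_of_nonneg {Y : H →L[ℂ] H} (hY : 0 ≤ Y) {p : ℝ} (hp : 0 < p) :
    schattenNorm e p Y = trace e (Y ^ p) ^ (1 / p) := by
  rw [schattenNorm, rpow_star_mul_self hY hp]

/-- Fatou's lemma: convergence is only in operator norm, so the trace is merely lower
semicontinuous, which suffices for upper bounds. -/
theorem trace_rpow_le_of_tendsto {Y : ℕ → H →L[ℂ] H} {Y₀ : H →L[ℂ] H}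
    (hY : Tendsto Y atTop (𝓝 Y₀)) (hpos : ∀ M, 0 ≤ Y M) {p : ℝ} (hp : 0 ≤ p) {C : ℝ≥0∞}
    (hC : ∀ᶠ M in atTop, trace e (Y M ^ p) ≤ C) : trace e (Y₀ ^ p) ≤ C := by
  refine ENNReal.tsum_le_of_sum_range_le fun K => ?_
  have h1 : Tendsto (fun M => ∑ n ∈ Finset.range K,
      ENNReal.ofReal (inner ℂ (e n) ((Y M ^ p) (e n))).re) atTop
      (𝓝 (∑ n ∈ Finset.range K, ENNReal.ofReal (inner ℂ (e n) ((Y₀ ^ p) (e n))).re)) := by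
    refine tendsto_finsetSum _ fun n _ => ENNReal.tendsto_ofReal ?_
    have h2 : Continuous fun T : H →L[ℂ] H => (inner ℂ (e n) (T (e n))).re :=
      Complex.continuous_re.comp (continuous_const.inner
        (ContinuousLinearMap.apply ℂ H (e n)).continuous)
    exact (h2.tendsto _).comp (tendsto_rpow hY hpos hp)
  refine le_of_tendsto h1 (hC.mono fun M hM => le_trans ?_ hM)
  exact ENNReal.sum_le_tsum _

theorem Diagonalises.entropyA_eq {X : H →L[ℂ] H} {r : ℕ} {x : ℕ → ℝ} {ψ : ℕ → H}
    (h : Diagonalises X r x ψ) {a : ℝ} (ha : 0 < a) :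
    entropyA e a X = ENNReal.ofReal (∑ j ∈ Finset.range r,
      Real.negMulLog (x j ^ (1 / a) / ∑ i ∈ Finset.range r, x i ^ (1 / a))) := by
  have hp : 0 < 1 / a := by positivity
  set Z := ∑ i ∈ Finset.range r, x i ^ (1 / a) with hZ
  have hxp : ∀ j, 0 ≤ x j ^ (1 / a) := fun j => Real.rpow_nonneg (h.nonneg j) _
  have hZ0 : 0 ≤ Z := Finset.sum_nonneg fun j _ => hxp j
  have h1 : Diagonalises ((Z⁻¹ : ℝ) • X ^ (1 / a)) r (fun j => x j ^ (1 / a) / Z) ψ := by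
    refine ⟨fun i j hij => ?_, fun j => by have := hxp j; positivity, fun j hj => ?_, h.orthonormal,
      h.vec_eq_zero, ?_⟩
    · exact div_le_div_of_nonneg_right
        (Real.rpow_le_rpow (h.nonneg j) (h.antitone hij) hp.le) hZ0
    · simp only [h.eq_zero j hj, Real.zero_rpow hp.ne', zero_div]
    · rw [h.rpow_eq hp, rankOneSum, rankOneSum, Finset.smul_sum]
      refine Finset.sum_congr rfl fun j _ => ?_
      rw [RCLike.real_smul_eq_coe_smul (K := ℂ), smul_smul]
      congr 1
      exact (Complex.ofReal_mul _ _).symm.trans (by simp [div_eq_inv_mul])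
  rw [entropyA, h.trace_rpow e hp, ENNReal.toReal_ofReal hZ0, entropy,
    h1.cfc_eq Real.continuous_negMulLog Real.negMulLog_zero]
  refine trace_rankOneSum e r (fun j => Real.negMulLog_nonneg (h1.nonneg j) ?_) h.norm_vec
  refine div_le_one_of_le₀ ?_ hZ0
  rcases lt_or_ge j r with hj | hj
  · exact Finset.single_le_sum (f := fun i => x i ^ (1 / a)) (fun i _ => hxp i)
      (Finset.mem_range.2 hj)
  · simpa only [h.eq_zero j hj, Real.zero_rpow hp.ne'] using hZ0

/-- Karamata's inequality for powers. -/
theorem sum_rpow_le_of_majorized {lam y : ℕ → ℝ} {M : ℕ} (hl : Antitone lam)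
    (hl0 : ∀ j, 0 ≤ lam j) (hy0 : ∀ j, 0 ≤ y j) {p : ℝ} (hp : 1 < p)
    (h : ∀ k ≤ M, ∑ j ∈ Finset.range k, lam j ≤ ∑ j ∈ Finset.range k, y j) :
    ∑ j ∈ Finset.range M, lam j ^ p ≤ ∑ j ∈ Finset.range M, y j ^ p := by
  -- Slopes of the tangents to `x ↦ x ^ p` at `lam j`. They decrease in `j`, so summation by parts
  -- exploits the partial-sum hypothesis; `y` itself need not be sorted.
  set c : ℕ → ℝ := fun j => p * lam j ^ (p - 1) with hc
  have hcanti : Antitone c := fun i j hij => mul_le_mul_of_nonneg_left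
    (Real.rpow_le_rpow (hl0 j) (hl hij) (by linarith)) (by linarith)
  have hc0 : ∀ j, 0 ≤ c j := fun j => mul_nonneg (by linarith) (Real.rpow_nonneg (hl0 j) _)
  have habel : ∀ m ≤ M, c m * ∑ j ∈ Finset.range m, (y j - lam j) ≤
      ∑ j ∈ Finset.range m, c j * (y j - lam j) := by
    intro m
    induction m with
    | zero => simp
    | succ m ih =>
      intro hm
      have h1 := ih (by omega)
      have h2 : 0 ≤ ∑ j ∈ Finset.range (m + 1), (y j - lam j) := by
        rw [Finset.sum_sub_distrib]
        exact sub_nonneg.2 (h _ hm)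
      have h3 := mul_le_mul_of_nonneg_right (hcanti (Nat.le_succ m)) h2
      refine h3.trans ?_
      rw [Finset.sum_range_succ, Finset.sum_range_succ _ m, mul_add]
      linarith
  have htan : ∀ j, lam j ^ p + c j * (y j - lam j) ≤ y j ^ p := by
    intro j
    rcases (hl0 j).eq_or_lt with h0 | h0
    · rw [hc]
      simp only [← h0, Real.zero_rpow (by linarith : p ≠ 0), Real.zero_rpow (by linarith : p - 1 ≠ 0)]
      simpa using Real.rpow_nonneg (hy0 j) p
    · have h1 := one_add_mul_self_le_rpow_one_add (s := y j / lam j - 1)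
        (by have := div_nonneg (hy0 j) h0.le; linarith) hp.le
      rw [add_sub_cancel, Real.div_rpow (hy0 j) h0.le, le_div_iff₀ (Real.rpow_pos_of_pos h0 p)] at h1
      refine le_trans (le_of_eq ?_) h1
      simp only [hc]
      rw [Real.rpow_sub_one h0.ne']
      field_simp
  have h1 := habel M le_rfl
  have h2 : 0 ≤ ∑ j ∈ Finset.range M, (y j - lam j) := by
    rw [Finset.sum_sub_distrib]
    exact sub_nonneg.2 (h _ le_rfl)
  have h3 := Finset.sum_le_sum fun j (_ : j ∈ Finset.range M) => htan j
  rw [Finset.sum_add_distrib] at h3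
  nlinarith [mul_nonneg (hc0 M) h2]

end Calculus

/-! ### The classical extremal problem on `ℕ`. -/

section Classical

/-- The entropy of the geometric distribution `(1 - t) tⁿ`. -/
noncomputable def geomEntropy (t : ℝ) : ℝ := Real.negMulLog t / (1 - t) - Real.log (1 - t)

/-- The logarithmic derivative of the Schatten norm, for the geometric distribution. -/
noncomputable def geomRate (a t : ℝ) : ℝ := (t ^ a - t) / (1 - t)

/-- The numerator of the derivative of `geomRate`. -/
noncomputable def rateSlope (a t : ℝ) : ℝ := a * t ^ (a - 1) + (1 - a) * t ^ a - 1

theorem hasDerivAt_geomEntropy {t : ℝ} (h0 : 0 < t) (h1 : t < 1) :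
    HasDerivAt geomEntropy (-Real.log t / (1 - t) ^ 2) t := by
  have hne : 1 - t ≠ 0 := by linarith
  have h2 : HasDerivAt (fun t : ℝ => 1 - t) (-1) t := by
    simpa using (hasDerivAt_id t).const_sub 1
  have h3 := ((Real.hasDerivAt_negMulLog h0.ne').div h2 hne).sub (h2.log hne)
  convert! h3 using 1
  rw [Real.negMulLog]
  field_simp
  ring

theorem hasDerivAt_geomRate (a : ℝ) {t : ℝ} (h0 : 0 < t) (h1 : t < 1) :
    HasDerivAt (geomRate a) (rateSlope a t / (1 - t) ^ 2) t := by
  have hne : 1 - t ≠ 0 := by linarith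
  have h2 : HasDerivAt (fun t : ℝ => 1 - t) (-1) t := by
    simpa using (hasDerivAt_id t).const_sub 1
  have h3 := ((Real.hasDerivAt_rpow_const (p := a) (Or.inl h0.ne')).sub (hasDerivAt_id t)).div h2 hne
  convert! h3 using 1
  simp only [rateSlope, Pi.sub_apply, id]
  have h4 : t ^ a = t * t ^ (a - 1) := by
    rw [Real.rpow_sub_one h0.ne']
    field_simp
  rw [h4]
  ring

theorem continuousOn_geomEntropy : ContinuousOn geomEntropy (Set.Ico 0 1) := by
  have h : ContinuousOn (fun t : ℝ => 1 - t) (Set.Ico 0 1) := by fun_prop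
  exact (Real.continuous_negMulLog.continuousOn.div h fun t ht => by linarith [ht.2]).sub
    (h.log fun t ht => by linarith [ht.2])

theorem continuousOn_geomRate {a : ℝ} (ha : 0 ≤ a) : ContinuousOn (geomRate a) (Set.Ico 0 1) :=
  ((Real.continuous_rpow_const ha).sub continuous_id).continuousOn.div (by fun_prop)
    fun t ht => by linarith [ht.2]

theorem geomEntropy_zero : geomEntropy 0 = 0 := by simp [geomEntropy]

theorem geomRate_zero {a : ℝ} (ha : a ≠ 0) : geomRate a 0 = 0 := by simp [geomRate, ha]

theorem strictMonoOn_geomEntropy : StrictMonoOn geomEntropy (Set.Ico 0 1) := by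
  refine strictMonoOn_of_deriv_pos (convex_Ico 0 1) continuousOn_geomEntropy fun t ht => ?_
  rw [interior_Ico] at ht
  rw [(hasDerivAt_geomEntropy ht.1 ht.2).deriv]
  exact div_pos (neg_pos.2 (Real.log_neg ht.1 ht.2)) (pow_pos (by linarith [ht.2]) 2)

theorem exists_geomEntropy_eq {S : ℝ} (hS : 0 ≤ S) : ∃ t ∈ Set.Ico (0 : ℝ) 1, geomEntropy t = S := by
  -- Chosen so that the term `-log (1 - b)` alone equals `S`; the intermediate value theorem applies
  -- on `[0, b]`.
  set b := 1 - Real.exp (-S) with hb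
  have hb0 : 0 ≤ b := by
    have : Real.exp (-S) ≤ 1 := Real.exp_le_one_iff.2 (by linarith)
    linarith
  have hb1 : b < 1 := by linarith [Real.exp_pos (-S)]
  have h1 : S ≤ geomEntropy b := by
    have h2 : Real.log (1 - b) = -S := by rw [hb, sub_sub_cancel, Real.log_exp]
    rw [geomEntropy, h2]
    have := div_nonneg (Real.negMulLog_nonneg hb0 hb1.le) (by linarith : 0 ≤ 1 - b)
    linarith
  have hsub : Set.Icc 0 b ⊆ Set.Ico (0 : ℝ) 1 := fun t ht => ⟨ht.1, ht.2.trans_lt hb1⟩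
  obtain ⟨t, ht, h⟩ := intermediate_value_Icc hb0 (continuousOn_geomEntropy.mono hsub)
    ⟨by rwa [geomEntropy_zero], h1⟩
  exact ⟨t, hsub ht, h⟩

/-- The derivative of the rate with respect to the entropy is `rateSlope a t / -log t`, and this
says it decreases: concavity. Writing `u = t ^ θ`, convexity of the exponential gives `u ^ b ≤ θ t ^
b + (1 - θ)`, and the constants in `rateSlope` add up to `rateSlope a u ≤ θ * rateSlope a t`. -/
theorem rateSlope_mul_log_le {a t u : ℝ} (ha0 : 0 < a) (ha1 : a < 1) (ht : 0 < t) (htu : t ≤ u)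
    (hu : u < 1) : rateSlope a u * -Real.log t ≤ rateSlope a t * -Real.log u := by
  have hu0 : 0 < u := ht.trans_le htu
  have hlt : 0 < -Real.log t := neg_pos.2 (Real.log_neg ht (htu.trans_lt hu))
  have hlu : 0 < -Real.log u := neg_pos.2 (Real.log_neg hu0 hu)
  set θ := Real.log u / Real.log t with hθ
  have hlog : Real.log u = θ * Real.log t := by
    rw [hθ, div_mul_cancel₀]
    linarith
  have hθ0 : 0 ≤ θ := by
    rw [hθ, ← neg_div_neg_eq]
    positivity
  have hθ1 : θ ≤ 1 := by
    rw [hθ, ← neg_div_neg_eq, div_le_one hlt]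
    exact neg_le_neg (Real.log_le_log ht htu)
  have hconv : ∀ b : ℝ, u ^ b ≤ θ * t ^ b + (1 - θ) := by
    intro b
    have h := convexOn_exp.2 (Set.mem_univ (Real.log t * b)) (Set.mem_univ 0) hθ0
      (sub_nonneg.2 hθ1) (by ring)
    rw [Real.rpow_def_of_pos hu0, Real.rpow_def_of_pos ht, hlog]
    simpa [mul_assoc] using h
  have h1 : rateSlope a u ≤ θ * rateSlope a t := by
    have h2 := mul_le_mul_of_nonneg_left (hconv (a - 1)) ha0.le
    have h3 := mul_le_mul_of_nonneg_left (hconv a) (sub_nonneg.2 ha1.le)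
    simp only [rateSlope]
    nlinarith
  have h4 := mul_le_mul_of_nonneg_right h1 hlt.le
  rw [hlog]
  linarith

/-- The rate lies below its tangent as a function of the entropy. -/
theorem exists_geomRate_le_tangent {a w : ℝ} (ha0 : 0 < a) (ha1 : a < 1) (hw0 : 0 < w)
    (hw1 : w < 1) : ∃ μ : ℝ, ∀ t ∈ Set.Ico (0 : ℝ) 1,
      geomRate a t ≤ geomRate a w + μ * (geomEntropy t - geomEntropy w) := by
  set μ := rateSlope a w / -Real.log w with hμ
  have hlw : 0 < -Real.log w := neg_pos.2 (Real.log_neg hw0 hw1)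
  have hc : ContinuousOn (fun t => geomRate a t - μ * geomEntropy t) (Set.Ico 0 1) :=
    (continuousOn_geomRate ha0.le).sub (continuousOn_const.mul continuousOn_geomEntropy)
  have hd : ∀ t, 0 < t → t < 1 → HasDerivAt (fun t => geomRate a t - μ * geomEntropy t)
      ((rateSlope a t - μ * -Real.log t) / (1 - t) ^ 2) t := fun t h0 h1 => by
    convert! (hasDerivAt_geomRate a h0 h1).sub ((hasDerivAt_geomEntropy h0 h1).const_mul μ) using 1
    ring
  refine ⟨μ, fun t ht => ?_⟩
  suffices h : geomRate a t - μ * geomEntropy t ≤ geomRate a w - μ * geomEntropy w by linarith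
  rcases le_total t w with h | h
  · have hmono : MonotoneOn (fun t => geomRate a t - μ * geomEntropy t) (Set.Icc 0 w) := by
      refine monotoneOn_of_deriv_nonneg (convex_Icc 0 w)
        (hc.mono fun t ht => ⟨ht.1, ht.2.trans_lt hw1⟩) ?_ ?_ <;> rw [interior_Icc]
      · exact fun t ht => (hd t ht.1 (ht.2.trans hw1)).differentiableAt.differentiableWithinAt
      · intro t ht
        rw [(hd t ht.1 (ht.2.trans hw1)).deriv]
        refine div_nonneg (sub_nonneg.2 ?_) (sq_nonneg _)
        rw [hμ, div_mul_eq_mul_div, div_le_iff₀ hlw]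
        exact rateSlope_mul_log_le ha0 ha1 ht.1 ht.2.le hw1
    exact hmono ⟨ht.1, h⟩ ⟨hw0.le, le_rfl⟩ h
  · have hanti : AntitoneOn (fun t => geomRate a t - μ * geomEntropy t) (Set.Ico w 1) := by
      refine antitoneOn_of_deriv_nonpos (convex_Ico w 1)
        (hc.mono fun t ht => ⟨hw0.le.trans ht.1, ht.2⟩) ?_ ?_ <;> rw [interior_Ico]
      · exact fun t ht => (hd t (hw0.trans ht.1) ht.2).differentiableAt.differentiableWithinAt
      · intro t ht
        rw [(hd t (hw0.trans ht.1) ht.2).deriv]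
        refine div_nonpos_of_nonpos_of_nonneg (sub_nonpos.2 ?_) (sq_nonneg _)
        rw [hμ, div_mul_eq_mul_div, le_div_iff₀ hlw]
        exact rateSlope_mul_log_le ha0 ha1 hw0 ht.1.le ht.2
    exact hanti ⟨le_rfl, hw1⟩ ⟨h, ht.2⟩ h

theorem sum_sum_Ico (b : ℕ → ℝ) (r : ℕ) : ∑ m ∈ Finset.range r, ∑ j ∈ Finset.Ico m r, b j =
    ∑ j ∈ Finset.range r, (j + 1) * b j := by
  induction r with
  | zero => simp
  | succ r ih =>
    rw [Finset.sum_range_succ, Finset.sum_range_succ _ r, ← ih]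
    have h : ∀ m ∈ Finset.range r, ∑ j ∈ Finset.Ico m (r + 1), b j =
        ∑ j ∈ Finset.Ico m r, b j + b r := fun m hm =>
      Finset.sum_Ico_succ_top (Finset.mem_range.1 hm).le b
    rw [Finset.sum_congr rfl h, Finset.sum_add_distrib]
    simp
    ring

theorem sum_rpow_mul_rpow_le {a : ℝ} (ha0 : 0 < a) (ha1 : a < 1) (s : Finset ℕ) {f g : ℕ → ℝ}
    (hf : ∀ j, 0 ≤ f j) (hg : ∀ j, 0 ≤ g j) :
    ∑ j ∈ s, f j ^ a * g j ^ (1 - a) ≤ (∑ j ∈ s, f j) ^ a * (∑ j ∈ s, g j) ^ (1 - a) := by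
  have hb : 0 < 1 - a := by linarith
  have hpq : (1 / a).HolderConjugate (1 / (1 - a)) := by
    rw [Real.holderConjugate_iff]
    refine ⟨?_, ?_⟩
    · rw [lt_div_iff₀ ha0]; linarith
    · simp
  have h := Real.inner_le_Lp_mul_Lq_of_nonneg s hpq (f := fun j => f j ^ a)
    (g := fun j => g j ^ (1 - a)) (fun j _ => Real.rpow_nonneg (hf j) _)
    (fun j _ => Real.rpow_nonneg (hg j) _)
  have e1 : ∀ j, (f j ^ a) ^ (1 / a) = f j := fun j => by
    rw [← Real.rpow_mul (hf j), mul_one_div_cancel ha0.ne', Real.rpow_one]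
  have e2 : ∀ j, (g j ^ (1 - a)) ^ (1 / (1 - a)) = g j := fun j => by
    rw [← Real.rpow_mul (hg j), mul_one_div_cancel hb.ne', Real.rpow_one]
  simpa only [e1, e2, one_div_one_div] using h

/-- The logarithmic Sobolev inequality for the pure death process on `ℕ`: at fixed entropy, the
geometric distribution maximises the rate. -/
theorem rate_le_geomRate {a : ℝ} (ha0 : 0 < a) (ha1 : a < 1) {q : ℕ → ℝ} {r : ℕ}
    (hq : ∀ j < r, 0 < q j) (hq0 : ∀ j, r ≤ j → q j = 0) (hsum : ∑ j ∈ Finset.range r, q j = 1)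
    {w : ℝ} (hw : w ∈ Set.Ico (0 : ℝ) 1)
    (hent : ∑ j ∈ Finset.range r, Real.negMulLog (q j) = geomEntropy w) :
    ∑ j ∈ Finset.range r, ((j + 1) * (q (j + 1) ^ a * q j ^ (1 - a)) - j * q j) ≤
      geomRate a w := by
  have hqn : ∀ j, 0 ≤ q j := fun j => by
    rcases lt_or_ge j r with h | h
    · exact (hq j h).le
    · exact (hq0 j h).ge
  set T : ℕ → ℝ := fun m => ∑ j ∈ Finset.Ico m r, q j with hT
  have hTs : ∀ m, m < r → T m = q m + T (m + 1) := fun m hm => Finset.sum_eq_sum_Ico_succ_bot hm q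
  have hTn : ∀ m, 0 ≤ T m := fun m => Finset.sum_nonneg fun j _ => hqn j
  have hTp : ∀ m < r, 0 < T m := fun m hm => by
    rw [hTs m hm]
    exact add_pos_of_pos_of_nonneg (hq m hm) (hTn _)
  have hT0 : T 0 = 1 := by
    rw [Finset.range_eq_Ico] at hsum
    exact hsum
  have hTr : T r = 0 := by simp [hT]
  -- The conditional probability of passing `m` given that `m` is reached; it is constant for a
  -- geometric law.
  set t : ℕ → ℝ := fun m => T (m + 1) / T m with ht
  have ht1 : ∀ m < r, t m ∈ Set.Ico (0 : ℝ) 1 := fun m hm =>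
    ⟨div_nonneg (hTn _) (hTn _), (div_lt_one (hTp m hm)).2 (by linarith [hq m hm, hTs m hm])⟩
  have hqt : ∀ m < r, q m = T m * (1 - t m) := fun m hm => by
    have := hTs m hm
    have h2 := (hTp m hm).ne'
    simp only [ht]
    field_simp
    linarith
  have hTt : ∀ m < r, T (m + 1) = T m * t m := fun m hm => by
    have h2 := (hTp m hm).ne'
    simp only [ht]
    field_simp
  -- The weights `j + 1` and `j` become sums over tails, and Hölder with exponents `1/a` and
  -- `1/(1-a)` is applied to each tail.
  have hrate : ∑ j ∈ Finset.range r, ((j + 1) * (q (j + 1) ^ a * q j ^ (1 - a)) - j * q j) ≤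
      ∑ m ∈ Finset.range r, q m * geomRate a (t m) := by
    have h1 : ∑ j ∈ Finset.range r, ((j + 1) * (q (j + 1) ^ a * q j ^ (1 - a)) - j * q j) =
        ∑ m ∈ Finset.range r, (∑ j ∈ Finset.Ico m r, q (j + 1) ^ a * q j ^ (1 - a) - T (m + 1)) := by
      have h2 : ∑ m ∈ Finset.range r, T (m + 1) = ∑ j ∈ Finset.range r, j * q j := by
        have h3 : ∑ m ∈ Finset.range r, T m = ∑ j ∈ Finset.range r, (j + 1) * q j := sum_sum_Ico q r
        have h4 := Finset.sum_congr rfl fun m hm => hTs m (Finset.mem_range.1 hm)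
        rw [Finset.sum_add_distrib, h3] at h4
        simp only [add_mul, one_mul, Finset.sum_add_distrib] at h4
        linarith
      rw [Finset.sum_sub_distrib, Finset.sum_sub_distrib, sum_sum_Ico, h2]
    rw [h1]
    refine Finset.sum_le_sum fun m hm => ?_
    have hm := Finset.mem_range.1 hm
    have h5 := sum_rpow_mul_rpow_le ha0 ha1 (Finset.Ico m r) (f := fun j => q (j + 1)) (g := q)
      (fun j => hqn _) hqn
    have h6 : ∑ j ∈ Finset.Ico m r, q (j + 1) = T (m + 1) := by
      rw [Finset.sum_Ico_add' q m r 1, Finset.sum_Ico_succ_top (by omega), hq0 r le_rfl, add_zero]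
    rw [h6] at h5
    change _ ≤ T (m + 1) ^ a * T m ^ (1 - a) at h5
    have h7 : T (m + 1) ^ a * T m ^ (1 - a) = T m * t m ^ a := by
      rw [hTt m hm, Real.mul_rpow (hTn m) (ht1 m hm).1, mul_right_comm, ← Real.rpow_add (hTp m hm)]
      simp
    have h8 : 1 - t m ≠ 0 := by linarith [(ht1 m hm).2]
    have h9 : q m * geomRate a (t m) = T m * t m ^ a - T (m + 1) := by
      rw [hqt m hm, hTt m hm, geomRate]
      field_simp
    rw [h9]
    linarith
  -- The chain rule for entropy: the terms in `T m` telescope, and both ends vanish since `T 0 = 1`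
  -- and `T r = 0`.
  have hentT : ∑ m ∈ Finset.range r, q m * geomEntropy (t m) = geomEntropy w := by
    have h1 : ∀ m ∈ Finset.range r, q m * geomEntropy (t m) = Real.negMulLog (q m) +
        (Real.negMulLog (T (m + 1)) - Real.negMulLog (T m)) := by
      intro m hm
      have hm := Finset.mem_range.1 hm
      have h8 : 1 - t m ≠ 0 := by linarith [(ht1 m hm).2]
      rw [hTt m hm, hqt m hm, geomEntropy, Real.negMulLog_mul, Real.negMulLog_mul,
        Real.negMulLog_def]
      field_simp
      ring
    rw [Finset.sum_congr rfl h1, Finset.sum_add_distrib, 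
      Finset.sum_range_sub (fun m => Real.negMulLog (T m)), hT0, hTr, hent]
    simp
  refine hrate.trans ?_
  -- No tangent is provided at entropy zero; there every `t m` must vanish and so does the rate.
  rcases hw.1.eq_or_lt with h0 | h0
  · rw [← h0, geomEntropy_zero] at hentT
    have hs0 : ∀ m < r, 0 ≤ geomEntropy (t m) := fun m hm => by
      rw [← geomEntropy_zero]
      exact strictMonoOn_geomEntropy.monotoneOn ⟨le_rfl, one_pos⟩ (ht1 m hm) (ht1 m hm).1
    have h2 := (Finset.sum_eq_zero_iff_of_nonneg fun m hm => mul_nonneg (hqn m)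
      (hs0 m (Finset.mem_range.1 hm))).1 hentT
    rw [← h0, geomRate_zero ha0.ne']
    refine le_of_eq (Finset.sum_eq_zero fun m hm => ?_)
    have hm' := Finset.mem_range.1 hm
    have h3 := (mul_eq_zero.1 (h2 m hm)).resolve_left (hq m hm').ne'
    rw [← geomEntropy_zero] at h3
    have h4 := strictMonoOn_geomEntropy.injOn (ht1 m hm') ⟨le_rfl, one_pos⟩ h3
    rw [h4, geomRate_zero ha0.ne', mul_zero]
  · obtain ⟨μ, hμ⟩ := exists_geomRate_le_tangent ha0 ha1 h0 hw.2
    calc ∑ m ∈ Finset.range r, q m * geomRate a (t m)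
        ≤ ∑ m ∈ Finset.range r, q m * (geomRate a w + μ * (geomEntropy (t m) - geomEntropy w)) :=
          Finset.sum_le_sum fun m hm => mul_le_mul_of_nonneg_left
            (hμ _ (ht1 m (Finset.mem_range.1 hm))) (hqn m)
      _ = (∑ m ∈ Finset.range r, q m) * (geomRate a w - μ * geomEntropy w) +
          μ * ∑ m ∈ Finset.range r, q m * geomEntropy (t m) := by
          rw [Finset.sum_mul, Finset.mul_sum, ← Finset.sum_add_distrib]
          exact Finset.sum_congr rfl fun m _ => by ring
      _ = geomRate a w := by rw [hsum, hentT]; ring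

end Classical

/-! ### The pure death process. -/

section Death

/-- The transition probabilities of the pure death process. -/
noncomputable def deathProb (n j : ℕ) (t : ℝ) : ℝ :=
  n.choose j * Real.exp (-t) ^ j * (1 - Real.exp (-t)) ^ (n - j)

theorem deathProb_eq_zero {n j : ℕ} (h : n < j) (t : ℝ) : deathProb n j t = 0 := by
  simp [deathProb, Nat.choose_eq_zero_of_lt h]

theorem deathProb_zero (n j : ℕ) : deathProb n j 0 = if n = j then 1 else 0 := by
  rcases lt_trichotomy n j with h | rfl | h
  · rw [deathProb_eq_zero h, if_neg h.ne]
  · simp [deathProb]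
  · have : n - j ≠ 0 := by omega
    simp [deathProb, this, h.ne']

theorem deathProb_nonneg (n j : ℕ) {t : ℝ} (ht : 0 ≤ t) : 0 ≤ deathProb n j t := by
  have : Real.exp (-t) ≤ 1 := Real.exp_le_one_iff.2 (by linarith)
  have := sub_nonneg.2 this
  unfold deathProb
  positivity

theorem sum_deathProb (n : ℕ) (t : ℝ) : ∑ j ∈ Finset.range (n + 1), deathProb n j t = 1 := by
  have h := add_pow (Real.exp (-t)) (1 - Real.exp (-t)) n
  rw [add_sub_cancel, one_pow] at h
  rw [h]
  exact Finset.sum_congr rfl fun j _ => by rw [deathProb]; ring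

theorem hasDerivAt_deathProb (n j : ℕ) (t : ℝ) : HasDerivAt (deathProb n j)
    ((j + 1) * deathProb n (j + 1) t - j * deathProb n j t) t := by
  have h1 : HasDerivAt (fun t : ℝ => Real.exp (-t)) (-Real.exp (-t)) t := by
    simpa using (hasDerivAt_neg t).exp
  have h2 := (((h1.fun_pow j).const_mul (n.choose j : ℝ))).mul ((h1.const_sub 1).fun_pow (n - j))
  convert! h2 using 1
  have h3 : (n.choose (j + 1) : ℝ) * (j + 1) = n.choose j * ((n - j : ℕ) : ℝ) := by
    exact_mod_cast Nat.choose_succ_right_eq n j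
  have h4 : (j : ℝ) * Real.exp (-t) ^ j = j * Real.exp (-t) ^ (j - 1) * Real.exp (-t) := by
    rcases j with _ | j
    · simp
    · rw [Nat.add_sub_cancel, pow_succ]; ring
  simp only [deathProb]
  rw [show n - (j + 1) = n - j - 1 by omega]
  set E := Real.exp (-t)
  set F := (1 - E) ^ (n - j - 1)
  set G := (1 - E) ^ (n - j)
  linear_combination (E ^ (j + 1) * F) * h3 - (n.choose j * G) * h4

variable (x : ℕ → ℝ) (r : ℕ)

/-- The evolution of the sequence `x` under the pure death process. -/
noncomputable def deathEvol (j : ℕ) (t : ℝ) : ℝ := ∑ n ∈ Finset.range r, x n * deathProb n j t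

theorem hasDerivAt_deathEvol (j : ℕ) (t : ℝ) : HasDerivAt (deathEvol x r j)
    ((j + 1) * deathEvol x r (j + 1) t - j * deathEvol x r j t) t := by
  have h := HasDerivAt.fun_sum (u := Finset.range r)
    fun n _ => (hasDerivAt_deathProb n j t).const_mul (x n)
  convert! h using 1
  simp only [deathEvol, Finset.mul_sum, ← Finset.sum_sub_distrib]
  exact Finset.sum_congr rfl fun n _ => by ring

theorem deathEvol_eq_zero {j : ℕ} (h : r ≤ j) (t : ℝ) : deathEvol x r j t = 0 :=
  Finset.sum_eq_zero fun n hn => by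
    rw [deathProb_eq_zero ((Finset.mem_range.1 hn).trans_le h), mul_zero]

theorem deathEvol_zero (hx : ∀ j, r ≤ j → x j = 0) (j : ℕ) : deathEvol x r j 0 = x j := by
  simp only [deathEvol, deathProb_zero, mul_ite, mul_one, mul_zero, Finset.sum_ite_eq',
    Finset.mem_range]
  split_ifs with h
  · rfl
  · exact (hx j (not_lt.1 h)).symm

theorem deathEvol_nonneg {x : ℕ → ℝ} (hx : ∀ j, 0 ≤ x j) (j : ℕ) {t : ℝ} (ht : 0 ≤ t) :
    0 ≤ deathEvol x r j t :=
  Finset.sum_nonneg fun n _ => mul_nonneg (hx n) (deathProb_nonneg n j ht)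

/-- The death rates telescope: only the flow from site `k` into the first `k` sites remains. The
partial sums thus solve the comparison system exactly. -/
theorem hasDerivAt_sum_deathEvol (k : ℕ) (t : ℝ) :
    HasDerivAt (fun t => ∑ j ∈ Finset.range k, deathEvol x r j t)
      (k * (∑ j ∈ Finset.range (k + 1), deathEvol x r j t -
        ∑ j ∈ Finset.range k, deathEvol x r j t)) t := by
  convert! HasDerivAt.fun_sum (u := Finset.range k) fun j _ => hasDerivAt_deathEvol x r j t using 1
  rw [Finset.sum_range_succ, add_sub_cancel_left]
  have h := Finset.sum_range_sub (fun j => (j : ℝ) * deathEvol x r j t) k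
  push_cast at h
  rw [h]
  simp

end Death

/-! ### Norm bounds for the attenuated operator. -/

section Bound

variable {H : Type*} [NormedAddCommGroup H] [InnerProductSpace ℂ H] [CompleteSpace H]
  (e : HilbertBasis ℕ ℂ H)

theorem Diagonalises.tendsto_attenuator {X : H →L[ℂ] H} {r : ℕ} {x : ℕ → ℝ} {ψ : ℕ → H}
    (hX : Diagonalises X r x ψ) {t : ℝ} (ht : 0 ≤ t) :
    Tendsto (fun M => NormedSpace.exp ((t : ℂ) • generator e M)
      (proj e M * X * proj e M)) atTop (𝓝 (attenuator e t X)) := by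
  have := exists_tendsto_exp_generator e r x hX.norm_vec_le ht
  rwa [← hX.eq_sum] at this

theorem proj_conj_nonneg {X : H →L[ℂ] H} (hX : 0 ≤ X) (M : ℕ) : 0 ≤ proj e M * X * proj e M :=
  (isSelfAdjoint_proj e M).conjugate_nonneg hX

theorem proj_conj_proj (X : H →L[ℂ] H) (M : ℕ) :
    proj e M * (proj e M * X * proj e M) * proj e M = proj e M * X * proj e M := by
  have := proj_mul_proj e (le_refl M)
  rw [mul_assoc, mul_assoc, this, ← mul_assoc, ← mul_assoc, this]

theorem exp_generator_proj_conj_nonneg {X : H →L[ℂ] H} (hX : 0 ≤ X) (M : ℕ) {t : ℝ} (ht : 0 ≤ t) :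
    0 ≤ NormedSpace.exp ((t : ℂ) • generator e M) (proj e M * X * proj e M) :=
  exp_lindblad_nonneg (ladder_mul_number e M) (proj_conj_nonneg e hX M) ht

theorem Diagonalises.attenuator_nonneg {X : H →L[ℂ] H} {r : ℕ} {x : ℕ → ℝ} {ψ : ℕ → H}
    (hX : Diagonalises X r x ψ) {t : ℝ} (ht : 0 ≤ t) : 0 ≤ attenuator e t X :=
  ge_of_tendsto' (hX.tendsto_attenuator e ht) fun M =>
    exp_generator_proj_conj_nonneg e hX.nonneg_op M ht

theorem Diagonalises.attenuator_zero {X : H →L[ℂ] H} {r : ℕ} {x : ℕ → ℝ} {ψ : ℕ → H}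
    (hX : Diagonalises X r x ψ) : attenuator e 0 X = X := by
  have h1 := hX.tendsto_attenuator e le_rfl
  simp only [exp_ofReal_zero_smul_apply] at h1
  refine tendsto_nhds_unique h1 ?_
  have h2 : ∀ M, proj e M * X * proj e M = rankOneSum r x fun j => proj e M (ψ j) := fun M => by
    rw [← mul_rankOneSum_mul, (isSelfAdjoint_proj e M).star_eq, hX.eq_sum]
  simp only [h2]
  conv => rhs; rw [hX.eq_sum]
  refine tendsto_finsetSum _ fun j _ => Tendsto.const_smul ?_ _
  have h3 : Continuous fun u : H => (InnerProductSpace.rankOne ℂ u u : H →L[ℂ] H) :=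
    ((ContinuousLinearMap.smulRightL ℂ H H).continuous.comp
      (innerSL ℂ : H →L⋆[ℂ] H →L[ℂ] ℂ).continuous).clm_apply continuous_id
  exact (h3.tendsto _).comp (tendsto_proj_apply e (ψ j))

/-- Weak majorization by the death process at each truncation `M ≥ r`, then Karamata, then
semicontinuity of the trace. -/
theorem Diagonalises.trace_attenuator_rpow_le {X : H →L[ℂ] H} {r : ℕ} {x : ℕ → ℝ} {ψ : ℕ → H}
    (hX : Diagonalises X r x ψ) {t : ℝ} (ht : 0 ≤ t) {p : ℝ} (hp : 1 < p) :
    trace e (attenuator e t X ^ p) ≤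
      ENNReal.ofReal (∑ j ∈ Finset.range r, deathEvol x r j t ^ p) := by
  have hp0 : 0 < p := by linarith
  refine trace_rpow_le_of_tendsto e (hX.tendsto_attenuator e ht)
    (fun M => exp_generator_proj_conj_nonneg e hX.nonneg_op M ht) hp0.le
    (eventually_atTop.2 ⟨r, fun M hM => ?_⟩)
  set Y := NormedSpace.exp ((t : ℂ) • generator e M) (proj e M * X * proj e M) with hY
  have hpos : 0 ≤ Y := exp_generator_proj_conj_nonneg e hX.nonneg_op M ht
  obtain ⟨y, φ, hd, -, -⟩ := exists_diagonalises
    ((ContinuousLinearMap.nonneg_iff_isPositive _).1 hpos) (fockSpan e M) (fun v => by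
      rw [hY, ← proj_conj_exp_generator e (proj_conj_proj e X M) t, mul_assoc]
      exact proj_mem_fockSpan e M _)
  rw [finrank_fockSpan] at hd
  rw [hd.trace_rpow e hp0]
  refine ENNReal.ofReal_le_ofReal ?_
  have h1 : ∑ j ∈ Finset.range M, deathEvol x r j t ^ p =
      ∑ j ∈ Finset.range r, deathEvol x r j t ^ p := by
    refine (Finset.sum_subset (Finset.range_mono hM) fun j _ hj => ?_).symm
    rw [deathEvol_eq_zero x r (not_lt.1 fun h => hj (Finset.mem_range.2 h)),
      Real.zero_rpow hp0.ne']
  rw [← h1]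
  refine sum_rpow_le_of_majorized hd.antitone hd.nonneg
    (fun j => deathEvol_nonneg r hX.nonneg j ht) hp fun k hk => ?_
  rw [← hd.kyFan_eq hk]
  refine hX.kyFan_exp_generator_le e (s := fun k t => ∑ j ∈ Finset.range k, deathEvol x r j t)
    (hasDerivAt_sum_deathEvol x r) (fun t => ?_) (fun k => ?_) hk ht
  · rw [Finset.sum_range_succ, deathEvol_eq_zero x r hM, add_zero]
  · exact Finset.sum_congr rfl fun j _ => deathEvol_zero x r hX.eq_zero j

theorem ladder_number_apply {M m : ℕ} (hm : m < M) :
    (star (ladder e M) * ladder e M) (e m) = ((m : ℝ) : ℂ) • e m := by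
  have h := congrArg (fun T : H →L[ℂ] H => T (e m)) (number_mul_ketbra e M m m hm)
  have h2 : ketbra e m m (e m) = e m := by
    simp [ketbra, e.orthonormal.1 m]
  rw [mul_apply_eq_comp, h2, smul_apply, h2] at h
  simpa using h

theorem continuous_re_inner_apply (v : H) :
    Continuous fun T : H →L[ℂ] H => (inner ℂ v (T v)).re :=
  Complex.continuous_re.comp (continuous_const.inner (ContinuousLinearMap.apply ℂ H v).continuous)

theorem re_inner_mono {S T : H →L[ℂ] H} (h : S ≤ T) (v : H) :
    (inner ℂ v (S v)).re ≤ (inner ℂ v (T v)).re := by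
  have h1 := ((ContinuousLinearMap.nonneg_iff_isPositive _).1 (sub_nonneg.2 h)).re_inner_nonneg_right v
  rw [sub_apply, inner_sub_right, map_sub] at h1
  exact sub_nonneg.1 h1

theorem proj_apply_basis {M m : ℕ} (hm : m < M) : proj e M (e m) = e m := by
  rw [proj_apply, Finset.sum_eq_single m]
  · simp [e.orthonormal.1 m]
  · intro j _ hj
    rw [e.orthonormal.2 hj, zero_smul]
  · intro h; exact absurd (Finset.mem_range.2 hm) h

theorem Diagonalises.exp_mul_le_attenuator {X : H →L[ℂ] H} {r : ℕ} {x : ℕ → ℝ} {ψ : ℕ → H}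
    (hX : Diagonalises X r x ψ) {t : ℝ} (ht : 0 ≤ t) (m : ℕ) :
    Real.exp (-t * m / 2) ^ 2 * (inner ℂ (e m) (X (e m))).re ≤
      (inner ℂ (e m) (attenuator e t X (e m))).re := by
  refine ge_of_tendsto (((continuous_re_inner_apply (e m)).tendsto _).comp
    (hX.tendsto_attenuator e ht)) (eventually_atTop.2 ⟨m + 1, fun M hM => ?_⟩)
  have h1 := re_inner_mono (damping_mul_self_le_exp_lindblad (ladder_mul_number e M)
    (proj_conj_nonneg e hX.nonneg_op M) ht) (e m)
  refine le_trans (le_of_eq ?_) h1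
  have h2 := damping_apply (ladder_number_apply e (show m < M by omega)) t
  have h3 : ∀ w, (inner ℂ (e m) (damping (ladder e M) t w) : ℂ) =
      inner ℂ (damping (ladder e M) t (e m)) w := fun w =>
    ((isSelfAdjoint_damping (ladder e M) t).isSymmetric (e m) w).symm
  have h4 : ∀ w, (inner ℂ (e m) (proj e M w) : ℂ) = inner ℂ (proj e M (e m)) w := fun w =>
    ((isSelfAdjoint_proj e M).isSymmetric (e m) w).symm
  simp only [mul_apply_eq_comp]
  rw [h3, h2, inner_smul_left, map_smul, map_smul, map_smul, inner_smul_right, h4,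
    proj_apply_basis e (show m < M by omega), Complex.conj_ofReal, Complex.re_ofReal_mul,
    Complex.re_ofReal_mul]
  ring

/-- A vanishing diagonal entry of `Y ^ p` puts `e m` in the kernel of `Y ^ (p / 2)`, hence in that
of `Y`. -/
theorem trace_rpow_pos {Y : H →L[ℂ] H} (hY : 0 ≤ Y) {p : ℝ} (hp : 0 < p) {m : ℕ}
    (hm : 0 < (inner ℂ (e m) (Y (e m))).re) : 0 < trace e (Y ^ p) := by
  rw [pos_iff_ne_zero]
  intro h
  rw [trace, ENNReal.tsum_eq_zero] at h
  have h1 := ENNReal.ofReal_eq_zero.1 (h m)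
  set S := Y ^ (p / 2) with hS
  have hS0 : 0 ≤ S := CFC.rpow_nonneg
  have h2 : Y ^ p = S * S := by
    rw [← pow_two, ← CFC.rpow_natCast S 2 hS0, hS,
      CFC.rpow_rpow_of_exponent_nonneg Y _ _ (by positivity) (by norm_num) hY]
    congr 1
    push_cast
    ring
  have h3 : (inner ℂ (e m) ((S * S) (e m)) : ℂ) = inner ℂ (S (e m)) (S (e m)) :=
    ((IsSelfAdjoint.of_nonneg hS0).isSymmetric (e m) (S (e m))).symm
  rw [h2, h3, inner_self_eq_norm_sq_to_K] at h1
  have h4 : S (e m) = 0 := by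
    have h5 : ‖S (e m)‖ ^ 2 ≤ 0 := by
      have : ((‖S (e m)‖ : ℂ) ^ 2).re = ‖S (e m)‖ ^ 2 := by norm_cast
      rw [← this]
      exact h1
    exact norm_eq_zero.1 (pow_eq_zero_iff two_ne_zero |>.1 (le_antisymm h5 (by positivity)))
  have h6 : Y = S ^ (2 / p) := by
    rw [hS, CFC.rpow_rpow_of_exponent_nonneg Y _ _ (by positivity) (by positivity) hY,
      show p / 2 * (2 / p) = 1 by field_simp, CFC.rpow_one Y hY]
  have h7 := rpow_apply_eigenvector hS0 (v := e m) (c := 0) (by simp [h4])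
    (p := 2 / p) (by positivity)
  rw [← h6, Real.zero_rpow (by positivity), Complex.ofReal_zero, zero_smul] at h7
  rw [h7, inner_zero_right] at hm
  exact lt_irrefl _ hm

theorem Diagonalises.trace_attenuator_rpow_pos {X : H →L[ℂ] H} {r : ℕ} {x : ℕ → ℝ} {ψ : ℕ → H}
    (hX : Diagonalises X r x ψ) (hr : 0 < r) (hx : ∀ j < r, 0 < x j) {t : ℝ} (ht : 0 ≤ t) {p : ℝ}
    (hp : 0 < p) : 0 < trace e (attenuator e t X ^ p) := by
  have h1 : ∃ m, 0 < (inner ℂ (e m) (X (e m))).re := by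
    by_contra! h
    have h2 := hasSum_re_inner_rankOneSum e r x hX.norm_vec
    rw [← hX.eq_sum] at h2
    have h3 := hasSum_le h h2 hasSum_zero
    exact absurd h3 (not_le.2 (Finset.sum_pos (fun j hj => hx j (Finset.mem_range.1 hj))
      ⟨0, Finset.mem_range.2 hr⟩))
  obtain ⟨m, hm⟩ := h1
  exact trace_rpow_pos e (hX.attenuator_nonneg e ht) hp
    ((mul_pos (by positivity) hm).trans_le (hX.exp_mul_le_attenuator e ht m))

end Bound

/-! ### Thermal states. -/

section Thermal

variable {H : Type*} [NormedAddCommGroup H] [InnerProductSpace ℂ H] [CompleteSpace H]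
  (e : HilbertBasis ℕ ℂ H)

theorem norm_ketbra_self (n : ℕ) : ‖ketbra e n n‖ = 1 := by
  rw [ketbra, InnerProductSpace.norm_rankOne, e.orthonormal.1, mul_one]

theorem ketbra_apply_basis (m n : ℕ) : ketbra e n n (e m) = if n = m then e m else 0 := by
  rw [ketbra, InnerProductSpace.rankOne_apply, orthonormal_iff_ite.1 e.orthonormal]
  split_ifs with h
  · rw [h, one_smul]
  · rw [zero_smul]

theorem ext_basis (e : HilbertBasis ℕ ℂ H) {S T : H →L[ℂ] H} (h : ∀ m, S (e m) = T (e m)) :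
    S = T :=
  ContinuousLinearMap.ext_on (by
    rw [dense_iff_closure_eq, ← Submodule.topologicalClosure_coe, e.dense_span,
      Submodule.top_coe]) (by rintro _ ⟨m, rfl⟩; exact h m)

theorem summable_thermal {z : ℝ} (hz0 : 0 ≤ z) (hz1 : z < 1) :
    Summable fun n : ℕ => (((1 - z) * z ^ n : ℝ) : ℂ) • ketbra e n n := by
  refine Summable.of_norm ?_
  have : ∀ n : ℕ, ‖(((1 - z) * z ^ n : ℝ) : ℂ) • ketbra e n n‖ = (1 - z) * z ^ n := fun n => by
    rw [norm_smul, norm_ketbra_self, mul_one, Complex.norm_real, Real.norm_of_nonneg]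
    have := sub_nonneg.2 hz1.le
    positivity
  simp only [this]
  exact (summable_geometric_of_lt_one hz0 hz1).mul_left _

theorem thermal_apply_basis {z : ℝ} (hz0 : 0 ≤ z) (hz1 : z < 1) (m : ℕ) :
    thermal e z (e m) = (((1 - z) * z ^ m : ℝ) : ℂ) • e m := by
  have h := (summable_thermal e hz0 hz1).hasSum.mapL (ContinuousLinearMap.apply ℂ H (e m))
  refine h.unique ?_
  convert! hasSum_ite_eq m ((((1 - z) * z ^ m : ℝ) : ℂ) • e m) using 2 with n
  rw [ContinuousLinearMap.apply_apply, smul_apply, ketbra_apply_basis]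
  split_ifs with h
  · rw [h]
  · rw [smul_zero]

theorem thermal_nonneg {z : ℝ} (hz0 : 0 ≤ z) (hz1 : z < 1) : 0 ≤ thermal e z := by
  refine tsum_nonneg fun n => ?_
  rw [Complex.coe_smul]
  have := sub_nonneg.2 hz1.le
  exact smul_nonneg (by positivity) (rankOne_self_nonneg _)

theorem proj_mul_thermal_mul_proj {z : ℝ} (hz0 : 0 ≤ z) (hz1 : z < 1) (M : ℕ) :
    proj e M * thermal e z * proj e M =
      ∑ n ∈ Finset.range M, (((1 - z) * z ^ n : ℝ) : ℂ) • ketbra e n n := by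
  refine ext_basis e fun m => ?_
  rw [sum_apply]
  simp only [smul_apply, ketbra_apply_basis, smul_ite, smul_zero, Finset.sum_ite_eq',
    Finset.mem_range, mul_apply_eq_comp]
  split_ifs with h
  · rw [proj_apply_basis e h, thermal_apply_basis e hz0 hz1, map_smul, proj_apply_basis e h]
  · have : proj e M (e m) = 0 := by
      rw [proj_apply]
      refine Finset.sum_eq_zero fun n hn => ?_
      have : n ≠ m := fun h' => h (h' ▸ Finset.mem_range.1 hn)
      rw [e.orthonormal.2 this, zero_smul]
    rw [this, map_zero, map_zero]

/-- The attenuated Fock state `e^{tL}(|n⟩⟨n|)`. -/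
noncomputable def attenuatedFock (n : ℕ) (t : ℝ) : H →L[ℂ] H :=
  ∑ k ∈ Finset.range (n + 1), (deathProb n k t : ℂ) • ketbra e k k

theorem exp_generator_ketbra {M n : ℕ} (hn : n < M) (t : ℝ) :
    NormedSpace.exp ((t : ℂ) • generator e M) (ketbra e n n) = attenuatedFock e n t := by
  have h1 : ∀ t : ℝ, HasDerivAt (attenuatedFock e n) (generator e M (attenuatedFock e n t)) t := by
    intro t
    have h2 := HasDerivAt.fun_sum (u := Finset.range (n + 1))
      fun k _ => (hasDerivAt_deathProb n k t).ofReal_comp.smul_const (ketbra e k k)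
    convert! h2 using 1
    rw [attenuatedFock, map_sum]
    have h3 : ∀ k ∈ Finset.range (n + 1),
        generator e M ((deathProb n k t : ℂ) • ketbra e k k) =
        ((k * deathProb n k t : ℝ) : ℂ) • ketbra e (k - 1) (k - 1) -
        ((k * deathProb n k t : ℝ) : ℂ) • ketbra e k k := by
      intro k hk
      have hk := Finset.mem_range.1 hk
      rw [map_smul, generator_ketbra e M k k (by omega) (by omega), smul_sub, smul_smul, smul_smul,
        Real.mul_self_sqrt (by positivity)]
      congr 2 <;> push_cast <;> ring
    rw [Finset.sum_congr rfl h3, Finset.sum_sub_distrib]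
    simp only [Complex.ofReal_sub, sub_smul, Finset.sum_sub_distrib]
    congr 1
    rw [Finset.sum_range_succ', Finset.sum_range_succ _ n, deathProb_eq_zero (Nat.lt_succ_self n)]
    simp
  rw [eq_exp_smul_apply h1 t]
  congr 1
  simp [attenuatedFock, deathProb_zero]

theorem norm_attenuatedFock_le (n : ℕ) {t : ℝ} (ht : 0 ≤ t) : ‖attenuatedFock e n t‖ ≤ 1 := by
  refine (norm_sum_le _ _).trans (le_of_eq ?_)
  rw [← sum_deathProb n t]
  refine Finset.sum_congr rfl fun k _ => ?_
  rw [norm_smul, norm_ketbra_self, mul_one, Complex.norm_real,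
    Real.norm_of_nonneg (deathProb_nonneg n k ht)]

theorem attenuatedFock_apply_basis (n m : ℕ) (t : ℝ) :
    attenuatedFock e n t (e m) = (deathProb n m t : ℂ) • e m := by
  rw [attenuatedFock, sum_apply]
  simp only [smul_apply, ketbra_apply_basis, smul_ite, smul_zero, Finset.sum_ite_eq',
    Finset.mem_range]
  split_ifs with h
  · rfl
  · rw [deathProb_eq_zero (by omega)]
    simp

/-- The parameter of the attenuated thermal state. -/
noncomputable def attenuatedParam (z t : ℝ) : ℝ :=
  Real.exp (-t) * z / (1 - z + Real.exp (-t) * z)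

theorem attenuatedParam_denom_pos {z : ℝ} (hz0 : 0 ≤ z) (hz1 : z < 1) (t : ℝ) :
    0 < 1 - z + Real.exp (-t) * z := by
  have := mul_nonneg (Real.exp_pos (-t)).le hz0
  linarith

theorem one_sub_attenuatedParam {z : ℝ} (hz0 : 0 ≤ z) (hz1 : z < 1) (t : ℝ) :
    1 - attenuatedParam z t = (1 - z) / (1 - z + Real.exp (-t) * z) := by
  have := (attenuatedParam_denom_pos hz0 hz1 t).ne'
  rw [attenuatedParam]
  field_simp
  ring

theorem attenuatedParam_mem {z : ℝ} (hz0 : 0 ≤ z) (hz1 : z < 1) (t : ℝ) :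
    attenuatedParam z t ∈ Set.Ico (0 : ℝ) 1 := by
  have h := attenuatedParam_denom_pos hz0 hz1 t
  refine ⟨div_nonneg (mul_nonneg (Real.exp_pos _).le hz0) h.le, ?_⟩
  rw [← sub_pos, one_sub_attenuatedParam hz0 hz1]
  exact div_pos (by linarith) h

theorem attenuatedParam_zero (z : ℝ) : attenuatedParam z 0 = z := by simp [attenuatedParam]

/-- Binomial thinning of a geometric law is geometric, by the negative binomial series; the terms
with `n < m` vanish and are shifted away. -/
theorem hasSum_thermal_deathProb {z : ℝ} (hz0 : 0 ≤ z) (hz1 : z < 1) {t : ℝ} (ht : 0 ≤ t) (m : ℕ) :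
    HasSum (fun n => (1 - z) * z ^ n * deathProb n m t)
      ((1 - attenuatedParam z t) * attenuatedParam z t ^ m) := by
  have hE1 : Real.exp (-t) ≤ 1 := Real.exp_le_one_iff.2 (by linarith)
  have hE0 := Real.exp_pos (-t)
  have hr : ‖z * (1 - Real.exp (-t))‖ < 1 := by
    rw [Real.norm_of_nonneg (mul_nonneg hz0 (by linarith))]
    nlinarith
  have h1 := (hasSum_choose_mul_geometric_of_norm_lt_one m hr).mul_left
    ((1 - z) * (z * Real.exp (-t)) ^ m)
  rw [← hasSum_nat_add_iff' m]
  have h2 : ∑ n ∈ Finset.range m, (1 - z) * z ^ n * deathProb n m t = 0 :=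
    Finset.sum_eq_zero fun n hn => by rw [deathProb_eq_zero (Finset.mem_range.1 hn), mul_zero]
  rw [h2, sub_zero]
  have hd := attenuatedParam_denom_pos hz0 hz1 t
  convert! h1 using 1
  · ext n
    rw [deathProb, Nat.add_sub_cancel, mul_pow z (1 - Real.exp (-t))]
    ring
  · rw [one_sub_attenuatedParam hz0 hz1, attenuatedParam,
      show 1 - z * (1 - Real.exp (-t)) = 1 - z + Real.exp (-t) * z by ring, div_pow, pow_succ]
    field_simp

/-- Thermal states may have infinite rank, so the finite-rank convergence result is not used; the
limit is an explicit series of attenuated Fock states. -/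
theorem attenuator_thermal {z : ℝ} (hz0 : 0 ≤ z) (hz1 : z < 1) {t : ℝ} (ht : 0 ≤ t) :
    attenuator e t (thermal e z) = thermal e (attenuatedParam z t) := by
  have h1 : Summable fun n : ℕ => (((1 - z) * z ^ n : ℝ) : ℂ) • attenuatedFock e n t := by
    refine Summable.of_norm_bounded ((summable_geometric_of_lt_one hz0 hz1).mul_left (1 - z))
      fun n => ?_
    have := sub_nonneg.2 hz1.le
    have h0 : 0 ≤ (1 - z) * z ^ n := by positivity
    rw [norm_smul, Complex.norm_real, Real.norm_of_nonneg h0]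
    exact mul_le_of_le_one_right h0 (norm_attenuatedFock_le e n ht)
  have h2 : Tendsto (fun M : ℕ => NormedSpace.exp ((t : ℂ) • generator e M)
      (proj e M * thermal e z * proj e M)) atTop
      (𝓝 (∑' n : ℕ, (((1 - z) * z ^ n : ℝ) : ℂ) • attenuatedFock e n t)) := by
    refine h1.hasSum.tendsto_sum_nat.congr fun M => ?_
    rw [proj_mul_thermal_mul_proj e hz0 hz1, map_sum]
    refine Finset.sum_congr rfl fun n hn => ?_
    rw [map_smul, exp_generator_ketbra e (Finset.mem_range.1 hn)]
  have h3 : attenuator e t (thermal e z) = _ := h2.limUnder_eq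
  rw [h3]
  refine ext_basis e fun m => ?_
  have hz := attenuatedParam_mem hz0 hz1 t
  rw [thermal_apply_basis e hz.1 hz.2]
  refine (h1.hasSum.mapL (ContinuousLinearMap.apply ℂ H (e m))).unique ?_
  have h4 := (Complex.hasSum_ofReal.2 (hasSum_thermal_deathProb hz0 hz1 ht m)).smul_const (e m)
  convert! h4 using 2 with n
  rw [ContinuousLinearMap.apply_apply, smul_apply, attenuatedFock_apply_basis, smul_smul,
    ← Complex.ofReal_mul]

theorem trace_of_apply_basis {T : H →L[ℂ] H} {c : ℕ → ℝ} (hc : ∀ m, 0 ≤ c m)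
    (hT : ∀ m, T (e m) = (c m : ℂ) • e m) {s : ℝ} (hs : HasSum c s) :
    trace e T = ENNReal.ofReal s := by
  rw [trace, ← hs.tsum_eq, ENNReal.ofReal_tsum_of_nonneg hc hs.summable]
  refine tsum_congr fun m => ?_
  rw [hT, inner_smul_right, inner_self_eq_norm_sq_to_K, e.orthonormal.1]
  simp

theorem thermal_rpow_apply_basis {z : ℝ} (hz0 : 0 ≤ z) (hz1 : z < 1) {p : ℝ} (hp : 0 < p) (m : ℕ) :
    (thermal e z ^ p) (e m) = (((1 - z) ^ p * (z ^ p) ^ m : ℝ) : ℂ) • e m := by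
  rw [rpow_apply_eigenvector (thermal_nonneg e hz0 hz1) (thermal_apply_basis e hz0 hz1 m) hp.le,
    Real.mul_rpow (by linarith) (by positivity), ← Real.rpow_natCast z m, ← Real.rpow_mul hz0,
    mul_comm (m : ℝ) p, Real.rpow_mul hz0, Real.rpow_natCast]

theorem trace_thermal_rpow {z : ℝ} (hz0 : 0 ≤ z) (hz1 : z < 1) {p : ℝ} (hp : 0 < p) :
    trace e (thermal e z ^ p) = ENNReal.ofReal ((1 - z) ^ p / (1 - z ^ p)) := by
  refine trace_of_apply_basis e (fun m => ?_) (thermal_rpow_apply_basis e hz0 hz1 hp) ?_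
  · have := sub_nonneg.2 hz1.le
    positivity
  · rw [div_eq_mul_inv]
    exact (hasSum_geometric_of_lt_one (Real.rpow_nonneg hz0 p)
      (Real.rpow_lt_one hz0 hz1 hp)).mul_left _

theorem hasSum_negMulLog_geometric {w : ℝ} (hw0 : 0 ≤ w) (hw1 : w < 1) :
    HasSum (fun m : ℕ => Real.negMulLog ((1 - w) * w ^ m)) (geomEntropy w) := by
  have hne : 1 - w ≠ 0 := by linarith
  have hn : ‖w‖ < 1 := by rwa [Real.norm_of_nonneg hw0]
  have h1 := ((hasSum_geometric_of_lt_one hw0 hw1).mul_left (Real.negMulLog (1 - w))).sub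
    ((hasSum_coe_mul_geometric_of_norm_lt_one hn).mul_left ((1 - w) * Real.log w))
  convert! h1 using 1
  · ext m
    have h2 : Real.negMulLog (w ^ m) = -w ^ m * (m * Real.log w) := by
      rw [Real.negMulLog, Real.log_pow]
    rw [Real.negMulLog_mul, h2]
    ring
  · rw [geomEntropy, Real.negMulLog, Real.negMulLog]
    field_simp
    ring

theorem entropyA_thermal {z : ℝ} (hz0 : 0 ≤ z) (hz1 : z < 1) {a : ℝ} (ha : 0 < a) :
    entropyA e a (thermal e z) = ENNReal.ofReal (geomEntropy (z ^ (1 / a))) := by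
  have hp : 0 < 1 / a := by positivity
  set w := z ^ (1 / a) with hw
  have hw0 : 0 ≤ w := Real.rpow_nonneg hz0 _
  have hw1 : w < 1 := Real.rpow_lt_one hz0 hz1 hp
  have hz : 0 < (1 - z) ^ (1 / a) := Real.rpow_pos_of_pos (by linarith) _
  have hZ : 0 ≤ (1 - z) ^ (1 / a) / (1 - w) := div_nonneg hz.le (by linarith)
  rw [entropyA, trace_thermal_rpow e hz0 hz1 hp, ENNReal.toReal_ofReal hZ, entropy]
  set Z := (1 - z) ^ (1 / a) / (1 - w) with hZdef
  have h1 : ∀ m, (Z⁻¹ • thermal e z ^ (1 / a)) (e m) = (((1 - w) * w ^ m : ℝ) : ℂ) • e m := by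
    intro m
    rw [smul_apply, thermal_rpow_apply_basis e hz0 hz1 hp, ← Complex.coe_smul, smul_smul,
      ← Complex.ofReal_mul, ← hw, hZdef, inv_div]
    congr 2
    field_simp
  have h2 : IsSelfAdjoint (Z⁻¹ • thermal e z ^ (1 / a)) :=
    IsSelfAdjoint.of_nonneg (smul_nonneg (inv_nonneg.2 hZ) CFC.rpow_nonneg)
  refine trace_of_apply_basis e (fun m => ?_)
    (fun m => cfc_apply_eigenvector h2 (h1 m) Real.continuous_negMulLog)
    (hasSum_negMulLog_geometric hw0 hw1)
  have h3 : 0 ≤ 1 - w := by linarith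
  exact Real.negMulLog_nonneg (by positivity)
    (mul_le_one₀ (by linarith) (by positivity) (pow_le_one₀ hw0 hw1.le))

theorem logNorm_thermal {z : ℝ} (hz0 : 0 ≤ z) (hz1 : z < 1) {a : ℝ} (ha : 0 < a) {t : ℝ}
    (ht : 0 ≤ t) : logNorm e a (thermal e z) t = Real.log (1 - attenuatedParam z t) -
      a * Real.log (1 - attenuatedParam z t ^ (1 / a)) := by
  have hp : 0 < 1 / a := by positivity
  obtain ⟨h0, h1⟩ := attenuatedParam_mem hz0 hz1 t
  have h2 : 0 < 1 - attenuatedParam z t := by linarith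
  have h3 : 0 < 1 - attenuatedParam z t ^ (1 / a) := sub_pos.2 (Real.rpow_lt_one h0 h1 hp)
  have h4 := Real.rpow_pos_of_pos h2 (1 / a)
  rw [logNorm, attenuator_thermal e hz0 hz1 ht, schattenNorm_of_nonneg e (thermal_nonneg e h0 h1) hp,
    trace_thermal_rpow e h0 h1 hp, ← ENNReal.toReal_rpow, ENNReal.toReal_ofReal (by positivity),
    Real.log_rpow (by positivity),
    Real.log_div h4.ne' h3.ne', Real.log_rpow h2]
  field_simp

theorem hasDerivAt_attenuatedParam (z : ℝ) :
    HasDerivAt (attenuatedParam z) (-(z * (1 - z))) 0 := by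
  have h1 : HasDerivAt (fun t : ℝ => Real.exp (-t) * z) (-z) 0 := by
    simpa using ((hasDerivAt_neg (0 : ℝ)).exp).mul_const z
  have h2 := h1.div (h1.const_add (1 - z)) (by simp)
  convert! h2 using 1
  simp
  ring

/-- The argument `z ^ (1 / a)` is the geometric parameter of the normalised power `1 / a` of the
thermal state, the same one that enters its entropy. -/
theorem hasDerivWithinAt_logNorm_thermal {z : ℝ} (hz0 : 0 ≤ z) (hz1 : z < 1) {a : ℝ} (ha0 : 0 < a)
    (ha1 : a < 1) : HasDerivWithinAt (logNorm e a (thermal e z)) (geomRate a (z ^ (1 / a)))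
      (Set.Ici 0) 0 := by
  have hp : 1 ≤ 1 / a := by rw [le_div_iff₀ ha0]; linarith
  have hw1 : z ^ (1 / a) < 1 := Real.rpow_lt_one hz0 hz1 (by positivity)
  have h1 := hasDerivAt_attenuatedParam z
  have h2 : HasDerivAt (fun t => 1 - attenuatedParam z t) (z * (1 - z)) 0 := by
    simpa using h1.const_sub 1
  have h3 : HasDerivAt (fun t => 1 - attenuatedParam z t ^ (1 / a))
      (z * (1 - z) * (1 / a) * z ^ (1 / a - 1)) 0 := by
    have := (h1.rpow_const (p := 1 / a) (Or.inr hp)).const_sub 1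
    rw [attenuatedParam_zero] at this
    convert! this using 1
    ring
  have h4 := (h2.log (by rw [attenuatedParam_zero]; linarith)).sub
    ((h3.log (by rw [attenuatedParam_zero]; linarith)).const_mul a)
  refine (h4.hasDerivWithinAt.congr (fun t ht => logNorm_thermal e hz0 hz1 ha0 ht)
    (logNorm_thermal e hz0 hz1 ha0 le_rfl)).congr_deriv ?_
  have h5 : z * z ^ (1 / a - 1) = z ^ (1 / a) := by
    rw [mul_comm, ← Real.rpow_add_one' hz0 (by simpa using ha0.ne'), sub_add_cancel]
  have h6 : (z ^ (1 / a)) ^ a = z := by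
    rw [← Real.rpow_mul hz0, one_div_mul_cancel ha0.ne', Real.rpow_one]
  have h7 : (1 - z) ≠ 0 := by linarith
  have h8 : 1 - z ^ (1 / a) ≠ 0 := by linarith
  rw [attenuatedParam_zero, geomRate, h6,
    show z * (1 - z) * (1 / a) * z ^ (1 / a - 1) = (z * z ^ (1 / a - 1)) * (1 - z) * (1 / a) by ring, h5]
  field_simp
  ring

end Thermal

/-! ### Assembling the inequality. -/

section Main

variable {H : Type*} [NormedAddCommGroup H] [InnerProductSpace ℂ H] [CompleteSpace H]
  (e : HilbertBasis ℕ ℂ H)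

theorem exists_diagonalises_pos {X : H →L[ℂ] H} (hpos : X.IsPositive)
    (hfin : FiniteDimensional ℂ X.range) (hX : X ≠ 0) :
    ∃ (r : ℕ) (x : ℕ → ℝ) (ψ : ℕ → H), 0 < r ∧ Diagonalises X r x ψ ∧ ∀ j < r, 0 < x j := by
  obtain ⟨x, ψ, hd, hmem, -⟩ := exists_diagonalises hpos X.range fun v => ⟨v, rfl⟩
  refine ⟨_, x, ψ, ?_, hd, fun j hj => (hd.nonneg j).lt_of_ne fun h => ?_⟩
  · rw [Nat.pos_iff_ne_zero]
    intro h
    exact hX (by rw [hd.eq_sum, h]; ext; simp [rankOneSum_apply])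
  -- An eigenvector of eigenvalue zero inside the range would be orthogonal to the range, hence to
  -- itself.
  · obtain ⟨u, hu⟩ := hmem j
    have h1 : X (ψ j) = 0 := by rw [hd.apply_vec, ← h]; simp
    have h2 : (inner ℂ (ψ j) (ψ j) : ℂ) = 0 :=
      (congrArg (fun v => (inner ℂ v (ψ j) : ℂ)) hu).symm.trans
        ((hpos.isSymmetric u (ψ j)).trans (by
          rw [ContinuousLinearMap.coe_coe, h1, inner_zero_right]))
    rw [hd.orthonormal j j hj hj, if_pos rfl] at h2
    exact one_ne_zero h2

theorem geomEntropy_nonneg {w : ℝ} (hw : w ∈ Set.Ico (0 : ℝ) 1) : 0 ≤ geomEntropy w := by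
  rw [← geomEntropy_zero]
  exact strictMonoOn_geomEntropy.monotoneOn ⟨le_rfl, zero_lt_one⟩ hw hw.1

theorem entropyA_thermal_eq_iff {z : ℝ} (hz : z ∈ Set.Ico (0 : ℝ) 1) {a : ℝ} (ha : 0 < a) {S : ℝ}
    (hS : 0 ≤ S) :
    entropyA e a (thermal e z) = ENNReal.ofReal S ↔ geomEntropy (z ^ (1 / a)) = S := by
  rw [entropyA_thermal e hz.1 hz.2 ha, ENNReal.ofReal_eq_ofReal_iff (geomEntropy_nonneg
    ⟨Real.rpow_nonneg hz.1 _, Real.rpow_lt_one hz.1 hz.2 (by positivity)⟩) hS]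

theorem existsUnique_geomEntropy_rpow {a : ℝ} (ha : 0 < a) {S : ℝ} (hS : 0 ≤ S) :
    ∃! z : ℝ, z ∈ Set.Ico (0 : ℝ) 1 ∧ geomEntropy (z ^ (1 / a)) = S := by
  have hp : 0 < 1 / a := by positivity
  obtain ⟨w, hw, hwS⟩ := exists_geomEntropy_eq hS
  have h1 : (w ^ a) ^ (1 / a) = w := by
    rw [← Real.rpow_mul hw.1, mul_one_div_cancel ha.ne', Real.rpow_one]
  refine ⟨w ^ a, ⟨⟨Real.rpow_nonneg hw.1 _, Real.rpow_lt_one hw.1 hw.2 ha⟩, by rw [h1, hwS]⟩, ?_⟩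
  rintro z ⟨hz, hzS⟩
  have h2 : z ^ (1 / a) = w := strictMonoOn_geomEntropy.injOn
    ⟨Real.rpow_nonneg hz.1 _, Real.rpow_lt_one hz.1 hz.2 hp⟩ hw (hzS.trans hwS.symm)
  rw [← h2, ← Real.rpow_mul hz.1, one_div_mul_cancel ha.ne', Real.rpow_one]

theorem rate_le_of_logNorm_le {a d : ℝ} {X : H →L[ℂ] H} {L : ℝ → ℝ} (hL : HasDerivAt L d 0)
    (h0 : logNorm e a X 0 = L 0) (hle : ∀ t, 0 < t → logNorm e a X t ≤ L t) :
    rate e a X ≤ (d : EReal) := by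
  have h1 : Tendsto (fun t : ℝ => (L t - L 0) / t) (𝓝[>] 0) (𝓝 d) := by
    have h2 := (hasDerivWithinAt_iff_tendsto_slope' (s := Set.Ioi (0 : ℝ)) (by simp)).1
      hL.hasDerivWithinAt
    refine h2.congr fun t => ?_
    rw [slope_def_field, sub_zero]
  rw [← ((continuous_coe_real_ereal.tendsto d).comp h1).limsup_eq, rate]
  refine limsup_le_limsup (eventually_nhdsWithin_of_forall fun t (ht : 0 < t) => ?_)
  rw [Function.comp_apply, EReal.coe_le_coe_iff, h0]
  exact div_le_div_of_nonneg_right (sub_le_sub_right (hle t ht) _) ht.le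

/-- The log-norm lies below that of the death process and agrees with it at `t = 0`, so the upper
derivative of the former is at most the derivative of the latter. -/
theorem Diagonalises.rate_le {X : H →L[ℂ] H} {r : ℕ} {x : ℕ → ℝ} {ψ : ℕ → H}
    (hX : Diagonalises X r x ψ) (hr : 0 < r) (hx : ∀ j < r, 0 < x j) {a : ℝ} (ha0 : 0 < a)
    (ha1 : a < 1) {Z : ℝ} (hZ : Z = ∑ j ∈ Finset.range r, x j ^ (1 / a)) :
    rate e a X ≤ ((∑ j ∈ Finset.range r,
      ((j + 1) * ((x (j + 1) ^ (1 / a) / Z) ^ a * (x j ^ (1 / a) / Z) ^ (1 - a)) -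
        j * (x j ^ (1 / a) / Z)) : ℝ) : EReal) := by
  have hp : 1 < 1 / a := by rw [lt_div_iff₀ ha0]; linarith
  have hp0 : 0 < 1 / a := by positivity
  have hZ0 : 0 < Z := by
    rw [hZ]
    exact Finset.sum_pos (fun j hj => Real.rpow_pos_of_pos (hx j (Finset.mem_range.1 hj)) _)
      ⟨0, Finset.mem_range.2 hr⟩
  set s : ℝ → ℝ := fun t => ∑ j ∈ Finset.range r, deathEvol x r j t ^ (1 / a) with hs
  have hs0 : s 0 = Z := by
    rw [hZ]
    exact Finset.sum_congr rfl fun j _ => by rw [deathEvol_zero x r hX.eq_zero]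
  have hs' : HasDerivAt s (∑ j ∈ Finset.range r,
      ((j + 1) * x (j + 1) - j * x j) * (1 / a) * x j ^ (1 / a - 1)) 0 := by
    refine HasDerivAt.fun_sum fun j _ => ?_
    have h := (hasDerivAt_deathEvol x r j 0).rpow_const (p := 1 / a) (Or.inr hp.le)
    simpa only [deathEvol_zero x r hX.eq_zero] using h
  have hL : HasDerivAt (fun t => a * Real.log (s t)) _ 0 :=
    (hs'.log (by rw [hs0]; exact hZ0.ne')).const_mul a
  -- Since `toReal` sends `∞` to zero and `Real.log 0 = 0`, the trace must be known to be finite and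
  -- strictly positive for the logarithm to be rewritten and compared.
  have hlog : ∀ t, 0 ≤ t → logNorm e a X t =
      a * Real.log (trace e (attenuator e t X ^ (1 / a))).toReal := fun t ht => by
    rw [logNorm, schattenNorm_of_nonneg e (hX.attenuator_nonneg e ht) hp0, one_div_one_div,
      ← ENNReal.toReal_rpow]
    have hle := hX.trace_attenuator_rpow_le e ht hp
    rw [Real.log_rpow (ENNReal.toReal_pos (hX.trace_attenuator_rpow_pos e hr hx ht hp0).ne'
      (hle.trans_lt ENNReal.ofReal_lt_top).ne)]
  have h1 := rate_le_of_logNorm_le e hL (a := a) (X := X) (by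
    rw [hlog 0 le_rfl, hX.attenuator_zero e, hX.trace_rpow e hp0, ← hZ, hs0,
      ENNReal.toReal_ofReal hZ0.le]) (fun t ht => by
    rw [hlog t ht.le]
    have hle := hX.trace_attenuator_rpow_le e ht.le hp
    have hst : 0 ≤ s t := Finset.sum_nonneg fun j _ =>
      Real.rpow_nonneg (deathEvol_nonneg r hX.nonneg j ht.le) _
    refine mul_le_mul_of_nonneg_left (Real.log_le_log (ENNReal.toReal_pos
      (hX.trace_attenuator_rpow_pos e hr hx ht.le hp0).ne'
      (hle.trans_lt ENNReal.ofReal_lt_top).ne) ?_) ha0.le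
    exact ENNReal.toReal_le_of_le_ofReal hst hle)
  refine h1.trans (le_of_eq ?_)
  rw [EReal.coe_eq_coe_iff, hs0, Finset.sum_div, Finset.mul_sum]
  refine Finset.sum_congr rfl fun j hj => ?_
  have hj := hx j (Finset.mem_range.1 hj)
  have h2 : ∀ y : ℝ, 0 ≤ y → (y ^ (1 / a) / Z) ^ a = y / Z ^ a := fun y hy => by
    rw [Real.div_rpow (Real.rpow_nonneg hy _) hZ0.le, ← Real.rpow_mul hy,
      one_div_mul_cancel ha0.ne', Real.rpow_one]
  have h3 : (x j ^ (1 / a) / Z) ^ (1 - a) = x j ^ (1 / a - 1) / Z ^ (1 - a) := by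
    rw [Real.div_rpow (Real.rpow_nonneg hj.le _) hZ0.le, ← Real.rpow_mul hj.le]
    congr 2
    field_simp
  have h4 : Z ^ a * Z ^ (1 - a) = Z := by
    rw [← Real.rpow_add hZ0, add_sub_cancel, Real.rpow_one]
  have h5 : x j ^ (1 / a) = x j * x j ^ (1 / a - 1) := by
    rw [← Real.rpow_one_add' hj.le (by simpa using ha0.ne'), add_sub_cancel]
  rw [h2 _ (hX.nonneg _), h3, div_mul_div_comm, h4, h5]
  field_simp

end Main

end OneMode

theorem mainTheorem5 {H : Type*} [NormedAddCommGroup H] [InnerProductSpace ℂ H] [CompleteSpace H]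
    (e : HilbertBasis ℕ ℂ H) (a : ℝ) (ha0 : 0 < a) (ha1 : a < 1) (X : H →L[ℂ] H)
    (hpos : X.IsPositive) (hfin : FiniteDimensional ℂ X.range) (hX : X ≠ 0) :
    (∃! z : ℝ, z ∈ Set.Ico (0 : ℝ) 1 ∧
      OneMode.entropyA e a (OneMode.thermal e z) = OneMode.entropyA e a X) ∧
    ∀ z ∈ Set.Ico (0 : ℝ) 1,
      OneMode.entropyA e a (OneMode.thermal e z) = OneMode.entropyA e a X →
      (∃ d : ℝ, HasDerivWithinAt (OneMode.logNorm e a (OneMode.thermal e z)) d (Set.Ici 0) 0 ∧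
        OneMode.rate e a (OneMode.thermal e z) = (d : EReal)) ∧
      OneMode.rate e a X ≤ OneMode.rate e a (OneMode.thermal e z) := by
  obtain ⟨r, x, ψ, hr, hd, hx⟩ := OneMode.exists_diagonalises_pos hpos hfin hX
  have hp : 0 < 1 / a := by positivity
  set Z := ∑ i ∈ Finset.range r, x i ^ (1 / a) with hZ
  have hxp : ∀ j < r, 0 < x j ^ (1 / a) := fun j hj => Real.rpow_pos_of_pos (hx j hj) _
  have hZ0 : 0 < Z :=
    Finset.sum_pos (fun j hj => hxp j (Finset.mem_range.1 hj)) ⟨0, Finset.mem_range.2 hr⟩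
  set q : ℕ → ℝ := fun j => x j ^ (1 / a) / Z with hq
  have hq_pos : ∀ j < r, 0 < q j := fun j hj => div_pos (hxp j hj) hZ0
  have hsum : ∑ j ∈ Finset.range r, q j = 1 := by
    rw [hq, ← Finset.sum_div, div_self hZ0.ne']
  have hS : 0 ≤ ∑ j ∈ Finset.range r, Real.negMulLog (q j) := by
    refine Finset.sum_nonneg fun j hj => Real.negMulLog_nonneg
      (hq_pos j (Finset.mem_range.1 hj)).le ?_
    rw [← hsum]
    exact Finset.single_le_sum (fun i hi => (hq_pos i (Finset.mem_range.1 hi)).le) hj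
  have hent : ∀ z ∈ Set.Ico (0 : ℝ) 1,
      OneMode.entropyA e a (OneMode.thermal e z) = OneMode.entropyA e a X ↔
      OneMode.geomEntropy (z ^ (1 / a)) = ∑ j ∈ Finset.range r, Real.negMulLog (q j) :=
    fun z hz => by
      rw [hd.entropyA_eq e ha0]
      exact OneMode.entropyA_thermal_eq_iff e hz ha0 hS
  refine ⟨?_, fun z hz hzS => ?_⟩
  · simpa only [and_congr_right (hent _)] using OneMode.existsUnique_geomEntropy_rpow ha0 hS
  · have hder := OneMode.hasDerivWithinAt_logNorm_thermal e hz.1 hz.2 ha0 ha1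
    have hrate := OneMode.rate_eq_of_hasDerivWithinAt e hder
    refine ⟨⟨_, hder, hrate⟩, ?_⟩
    rw [hrate]
    refine (hd.rate_le e hr hx ha0 ha1 hZ).trans (EReal.coe_le_coe_iff.2 ?_)
    refine OneMode.rate_le_geomRate ha0 ha1 hq_pos (fun j hj => ?_) hsum
      ⟨Real.rpow_nonneg hz.1 _, Real.rpow_lt_one hz.1 hz.2 hp⟩ ((hent z hz).1 hzS).symm
    simp only [hq, hd.eq_zero j hj, Real.zero_rpow hp.ne', zero_div]
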